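/- For each $n$ let $x=x_n\in\mathbb R^n$ be a deterministic vector with exactly $k=k(n)$ nonzero entries, with sparsity pattern $I_{\rm true}=\{j: x_j\neq 0\}$, and let $y=Ax+d\in\mathbb R^m$, $m=m(n)\ge 1$, where $A\in\mathbb R^{m\times n}$ has i.i.d. $\mathcal N(0,1/m)$ entries and $d\in\mathbb R^m$ is independent of $A$ with i.i.d. $\mathcal N(0,1)$ entries. Put $$\mathrm{SNR}=\frac{\mathbf E\|Ax\|^2}{\mathbf E\|d\|^2},\qquad \mathrm{MAR}=\frac{\min_{j\in I_{\rm true}}|x_j|^2}{\|x\|^2/k}.$$ For $J\subseteq\{1,\dots,n\}$ let $P_J$ be the orthogonal projection onto the span of the columns $a_j$ of $A$ with $j\in J$, and let $\hat I_{\rm ML}=\arg\max_{|J|=k}\|P_Jy\|^2$; the event $\hat I_{\rm ML}=I_{\rm true}$ means that $I_{\rm true}$ is the unique maximizer. Suppose that $k(n)\to\infty$ and $n-k(n)\to\infty$ as $n\to\infty$. (1) If for some $\delta>0$ and all large $n$ $$m(n)<\frac{2-\delta}{\mathrm{MAR}\cdot\mathrm{SNR}}\,k\log(n-k)+k-1,$$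 then $\lim_{n\to\infty}\Pr(\hat I_{\rm ML}=I_{\rm true})=0$. If moreover $m(n)>k(n)$ for all large $n$, then even the probability that $I_{\rm true}$ is one of the maximizers tends to $0$ (so that ties may be broken in any way). (2) Consequently, for fixed SNR and MAR, $m=\Omega(k\log(n-k))$ measurements are necessary for any algorithm: let $s>0$ and $0<\rho\le 1$, and let $\hat I_n$ be any measurable estimators, functions of $(A,y)$, such that $\Pr(\hat I_n(A,y)=I_{\rm true})\to 1$ for every sequence of vectors $x_n$ with exactly $k(n)$ nonzero entries, $\mathrm{SNR}=s$ and $\mathrm{MAR}=\rho$ for all large $n$. Then $k\log(n-k)=O(m)$. -/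

import Mathlib

open MeasureTheory ProbabilityTheory Filter Topology Asymptotics
open scoped Matrix

noncomputable section

namespace SparseRecovery

/-- Sample space: a pair `(A, d)` of an `m × n` array of matrix entries and a noise vector. -/
abbrev Sample (m n : ℕ) : Type := (Fin m → Fin n → ℝ) × (Fin m → ℝ)

/-- The law of `(A, d)`: all entries are independent, those of `A` are `N(0, 1/m)` and those of
`d` are `N(0, 1)`. -/
def law (m n : ℕ) : Measure (Sample m n) :=
  (Measure.pi fun _ : Fin m => Measure.pi fun _ : Fin n => gaussianReal 0 (1 / m)).prod
    (Measure.pi fun _ : Fin m => gaussianReal 0 1)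

/-- The noiseless measurement `A x`. -/
def signal {m n : ℕ} (A : Fin m → Fin n → ℝ) (x : EuclideanSpace ℝ (Fin n)) :
    EuclideanSpace ℝ (Fin m) :=
  WithLp.toLp 2 (Matrix.of A *ᵥ x.ofLp)

/-- The observation `y = A x + d`. -/
def obs {m n : ℕ} (x : EuclideanSpace ℝ (Fin n)) (ω : Sample m n) : EuclideanSpace ℝ (Fin m) :=
  signal ω.1 x + WithLp.toLp 2 ω.2

/-- The set of positions of the nonzero entries of `x`. -/
def pattern {n : ℕ} (x : EuclideanSpace ℝ (Fin n)) : Finset (Fin n) :=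
  {j | x j ≠ 0}

/-- `SNR = E‖A x‖² / E‖d‖²`. -/
def SNR (m : ℕ) {n : ℕ} (x : EuclideanSpace ℝ (Fin n)) : ℝ :=
  (∫ ω, ‖signal ω.1 x‖ ^ 2 ∂law m n) /
    (∫ ω, ‖(WithLp.toLp 2 ω.2 : EuclideanSpace ℝ (Fin m))‖ ^ 2 ∂law m n)

/-- Minimum-to-average ratio: the least `|x_j|²` over the sparsity pattern, divided by the average
of `|x_j|²` over the sparsity pattern. -/
def MAR {n : ℕ} (x : EuclideanSpace ℝ (Fin n)) : ℝ :=
  (⨅ j : pattern x, |x j| ^ 2) / (‖x‖ ^ 2 / (pattern x).card)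

/-- The span of the columns `a_j`, `j ∈ J`, of `A`. -/
def colSpan {m n : ℕ} (A : Fin m → Fin n → ℝ) (J : Finset (Fin n)) :
    Submodule ℝ (EuclideanSpace ℝ (Fin m)) :=
  Submodule.span ℝ ((fun j => WithLp.toLp 2 fun i => A i j) '' (J : Set (Fin n)))

/-- `‖P_J y‖²`, where `P_J` is the orthogonal projection onto the span of the columns in `J`. -/
def energy {m n : ℕ} (A : Fin m → Fin n → ℝ) (y : EuclideanSpace ℝ (Fin m))
    (J : Finset (Fin n)) : ℝ :=
  ‖(colSpan A J).starProjection y‖ ^ 2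

/-- The maximizers of `‖P_J y‖²` over the index sets `J` with `k` elements. -/
def mlEstimates {m n : ℕ} (k : ℕ) (A : Fin m → Fin n → ℝ) (y : EuclideanSpace ℝ (Fin m)) :
    Set (Finset (Fin n)) :=
  {J | J.card = k ∧ ∀ J' : Finset (Fin n), J'.card = k → energy A y J' ≤ energy A y J}

end SparseRecovery

end

/-!
If the observation were independent of the columns of `A`, no rule could single out the true column
among `N` exchangeable ones with probability more than `1 / N`. The true law of the columns together
with the observation has a density with respect to such a reference law with the same marginals.
For a column with signal `N(0, u)` in each of `M` dimensions, the log-likelihood ratio has mean at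
most `M u / 2` and variance at most `M u`, so by Chebyshev's inequality the probability of success
is at most `exp τ / N + M u / (τ - M u / 2) ^ 2` for every `τ > M u / 2`. This tends to `0` when
`M u ≤ (2 - δ) log N`.

For the maximum likelihood estimator, condition on all columns of the pattern except the one with
the smallest coefficient. Projecting onto their orthogonal complement leaves a test for a single
column among `N = n - k + 1` in `M = m - k + 1` dimensions with `u = MAR * SNR / k`. For an
arbitrary estimator, reveal all but one index of the pattern: the decision events for the possible
last indices are disjoint, so one of them has reference probability at most `1 / N`, now with
`M = m`. Vectors whose entries are all equal, except for one large entry that adjusts the norm, turn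
this into the bound for given SNR and MAR.
-/

noncomputable section

open scoped NNReal ENNReal

namespace SparseRecovery

section GaussianMoments

lemma integrable_pow_gaussianReal (σ : ℝ≥0) (p : ℕ) :
    Integrable (fun x : ℝ => x ^ p) (gaussianReal 0 σ) :=
  (integrable_norm_iff (by fun_prop)).1 <| by
    simpa using (memLp_id_gaussianReal (μ := 0) (v := σ) p).integrable_norm_pow'

-- Integration by parts: `-σ` times the density is a primitive of `x` times the density.
lemma integral_pow_add_two_gaussianReal (σ : ℝ≥0) (p : ℕ) :
    ∫ x, x ^ (p + 2) ∂gaussianReal 0 σ = (p + 1) * σ * ∫ x, x ^ p ∂gaussianReal 0 σ := by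
  rcases eq_or_ne σ 0 with rfl | hσ
  · simp
  have hint (q : ℕ) : Integrable fun x => x ^ q * gaussianPDFReal 0 σ x := by
    have h := integrable_pow_gaussianReal σ q
    rw [gaussianReal_of_var_ne_zero _ hσ, integrable_withDensity_iff_integrable_smul' (by fun_prop)
      (by simp [gaussianPDF_lt_top])] at h
    simpa [toReal_gaussianPDF, mul_comm] using h
  have hderiv (x : ℝ) :
      HasDerivAt (fun x => -σ * gaussianPDFReal 0 σ x) (x * gaussianPDFReal 0 σ x) x := by
    have hexp : HasDerivAt (fun x : ℝ => -(x - 0) ^ 2 / (2 * σ)) (-x / σ) x := by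
      refine ((((hasDerivAt_id x).sub_const 0).pow 2).neg.div_const _).congr_deriv ?_
      simp only [id_eq, mul_one, Nat.cast_ofNat, Nat.add_one_sub_one, pow_one, sub_zero]
      field_simp
    refine ((hexp.exp.const_mul (√(2 * Real.pi * σ))⁻¹).const_mul (-(σ : ℝ))).congr_deriv ?_
    simp only [gaussianPDFReal]
    field_simp
  have hparts := integral_mul_deriv_eq_deriv_mul_of_integrable
    (u := fun x : ℝ => x ^ (p + 1)) (u' := fun x => (p + 1) * x ^ p)
    (v := fun x => -σ * gaussianPDFReal 0 σ x) (v' := fun x => x * gaussianPDFReal 0 σ x)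
    (fun x _ => by simpa using hasDerivAt_pow (p + 1) x) (fun x _ => hderiv x)
    ((hint (p + 2)).congr (ae_of_all _ fun x => by simp only [Pi.mul_apply]; ring))
    (((hint p).const_mul (-((p + 1) * σ))).congr
      (ae_of_all _ fun x => by simp only [Pi.mul_apply]; ring))
    (((hint (p + 1)).const_mul (-σ)).congr (ae_of_all _ fun x => by simp only [Pi.mul_apply]; ring))
  simp only [integral_gaussianReal_eq_integral_smul hσ, smul_eq_mul]
  calc ∫ x, gaussianPDFReal 0 σ x * x ^ (p + 2)
      = ∫ x, x ^ (p + 1) * (x * gaussianPDFReal 0 σ x) := by congr with x; ring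
    _ = ∫ x, (p + 1) * σ * (gaussianPDFReal 0 σ x * x ^ p) := by
      rw [hparts, ← integral_neg]; congr with x; ring
    _ = (p + 1) * σ * ∫ x, gaussianPDFReal 0 σ x * x ^ p := integral_const_mul _ _

lemma integral_sq_gaussianReal (σ : ℝ≥0) : ∫ x, x ^ 2 ∂gaussianReal 0 σ = σ := by
  simpa using integral_pow_add_two_gaussianReal σ 0

lemma integral_pow_four_gaussianReal (σ : ℝ≥0) : ∫ x, x ^ 4 ∂gaussianReal 0 σ = 3 * σ ^ 2 := by
  rw [integral_pow_add_two_gaussianReal σ 2, integral_sq_gaussianReal]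
  push_cast
  ring

end GaussianMoments

section QuadraticForm

variable (σ τ : ℝ≥0) (a b c : ℝ)

lemma integrable_pow_mul_pow (i j : ℕ) :
    Integrable (fun p : ℝ × ℝ => p.1 ^ i * p.2 ^ j) ((gaussianReal 0 σ).prod (gaussianReal 0 τ)) :=
  (integrable_pow_gaussianReal σ i).mul_prod (integrable_pow_gaussianReal τ j)

lemma integral_pow_mul_pow (i j : ℕ) :
    ∫ p : ℝ × ℝ, p.1 ^ i * p.2 ^ j ∂((gaussianReal 0 σ).prod (gaussianReal 0 τ)) =
      (∫ x, x ^ i ∂gaussianReal 0 σ) * ∫ x, x ^ j ∂gaussianReal 0 τ :=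
  integral_prod_mul (fun x : ℝ => x ^ i) (fun x : ℝ => x ^ j)

lemma memLp_quadraticForm :
    MemLp (fun p : ℝ × ℝ => a * p.1 ^ 2 + b * p.2 ^ 2 + c * (p.1 * p.2)) 2
      ((gaussianReal 0 σ).prod (gaussianReal 0 τ)) := by
  have hmon (i j : ℕ) : MemLp (fun p : ℝ × ℝ => p.1 ^ i * p.2 ^ j) 2
      ((gaussianReal 0 σ).prod (gaussianReal 0 τ)) := by
    refine (memLp_two_iff_integrable_sq (by fun_prop)).2 ?_
    simpa only [mul_pow, ← pow_mul] using integrable_pow_mul_pow σ τ (i * 2) (j * 2)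
  simpa [Pi.add_def] using
    (((hmon 2 0).const_mul a).add ((hmon 0 2).const_mul b)).add ((hmon 1 1).const_mul c)

lemma integral_quadraticForm :
    ∫ p : ℝ × ℝ, a * p.1 ^ 2 + b * p.2 ^ 2 + c * (p.1 * p.2)
      ∂((gaussianReal 0 σ).prod (gaussianReal 0 τ)) = a * σ + b * τ := by
  have hint := integrable_pow_mul_pow σ τ
  have hmom := integral_pow_mul_pow σ τ
  calc _ = ∫ p : ℝ × ℝ, a * (p.1 ^ 2 * p.2 ^ 0) + b * (p.1 ^ 0 * p.2 ^ 2) +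
        c * (p.1 ^ 1 * p.2 ^ 1) ∂((gaussianReal 0 σ).prod (gaussianReal 0 τ)) := by simp
    _ = _ := by
      rw [integral_add (((hint 2 0).const_mul a).fun_add ((hint 0 2).const_mul b))
        ((hint 1 1).const_mul c), integral_add ((hint 2 0).const_mul a) ((hint 0 2).const_mul b)]
      simp only [integral_const_mul, hmom]
      simp [integral_sq_gaussianReal]

lemma variance_quadraticForm :
    Var[fun p : ℝ × ℝ => a * p.1 ^ 2 + b * p.2 ^ 2 + c * (p.1 * p.2);
      (gaussianReal 0 σ).prod (gaussianReal 0 τ)] =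
      2 * a ^ 2 * σ ^ 2 + 2 * b ^ 2 * τ ^ 2 + c ^ 2 * σ * τ := by
  have hint := integrable_pow_mul_pow σ τ
  have hmom := integral_pow_mul_pow σ τ
  have hexpand : ∀ p : ℝ × ℝ, (a * p.1 ^ 2 + b * p.2 ^ 2 + c * (p.1 * p.2)) ^ 2 =
      a ^ 2 * (p.1 ^ 4 * p.2 ^ 0) + b ^ 2 * (p.1 ^ 0 * p.2 ^ 4) +
        (c ^ 2 + 2 * a * b) * (p.1 ^ 2 * p.2 ^ 2) + 2 * a * c * (p.1 ^ 3 * p.2 ^ 1) +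
        2 * b * c * (p.1 ^ 1 * p.2 ^ 3) := by
    intro p; ring
  have h₂ := ((hint 4 0).const_mul (a ^ 2)).fun_add ((hint 0 4).const_mul (b ^ 2))
  have h₃ := h₂.fun_add ((hint 2 2).const_mul (c ^ 2 + 2 * a * b))
  have h₄ := h₃.fun_add ((hint 3 1).const_mul (2 * a * c))
  have hsq : ∫ p : ℝ × ℝ, (a * p.1 ^ 2 + b * p.2 ^ 2 + c * (p.1 * p.2)) ^ 2
      ∂((gaussianReal 0 σ).prod (gaussianReal 0 τ)) =
      3 * a ^ 2 * σ ^ 2 + 3 * b ^ 2 * τ ^ 2 + (c ^ 2 + 2 * a * b) * (σ * τ) := by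
    simp only [hexpand]
    rw [integral_add h₄ ((hint 1 3).const_mul _),
      integral_add h₃ ((hint 3 1).const_mul _), integral_add h₂ ((hint 2 2).const_mul _),
      integral_add ((hint 4 0).const_mul _) ((hint 0 4).const_mul _)]
    simp only [integral_const_mul, hmom]
    simp only [integral_sq_gaussianReal, integral_pow_four_gaussianReal, pow_zero, pow_one,
      integral_const, probReal_univ, smul_eq_mul, integral_id_gaussianReal]
    ring
  rw [variance_eq_sub (memLp_quadraticForm σ τ a b c), integral_quadraticForm]
  simp only [Pi.pow_apply, hsq]
  ring

end QuadraticForm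

lemma withDensity_apply_le_mul_add {α : Type*} [MeasurableSpace α] (μ : Measure α) {f : α → ℝ≥0∞}
    (hf : Measurable f) (c : ℝ≥0∞) {F : Set α} (hF : MeasurableSet F) :
    μ.withDensity f F ≤ c * μ F + μ.withDensity f {x | c < f x} := by
  have hle : MeasurableSet (F ∩ {x | f x ≤ c}) := hF.inter (measurableSet_le hf measurable_const)
  calc μ.withDensity f F
      ≤ μ.withDensity f (F ∩ {x | f x ≤ c} ∪ {x | c < f x}) :=
        measure_mono fun x hx => (le_or_gt (f x) c).imp (fun h => ⟨hx, h⟩) id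
    _ ≤ μ.withDensity f (F ∩ {x | f x ≤ c}) + μ.withDensity f {x | c < f x} :=
        measure_union_le _ _
    _ ≤ c * μ F + μ.withDensity f {x | c < f x} := by
        gcongr
        rw [withDensity_apply _ hle]
        calc ∫⁻ x in F ∩ {x | f x ≤ c}, f x ∂μ
            ≤ ∫⁻ _ in F ∩ {x | f x ≤ c}, c ∂μ := setLIntegral_mono measurable_const fun x hx => hx.2
          _ ≤ c * μ F := by
            rw [setLIntegral_const]
            gcongr
            exact Set.inter_subset_left

lemma pi_withDensity {ι : Type*} [Fintype ι] {α : ι → Type*} [∀ i, MeasurableSpace (α i)]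
    (μ : ∀ i, Measure (α i)) [∀ i, IsProbabilityMeasure (μ i)] {f : ∀ i, α i → ℝ≥0∞}
    (hf : ∀ i, Measurable (f i)) [∀ i, SigmaFinite ((μ i).withDensity (f i))] :
    Measure.pi (fun i => (μ i).withDensity (f i)) =
      (Measure.pi μ).withDensity fun x => ∏ i, f i (x i) := by
  refine Measure.pi_eq fun s hs => ?_
  have hm (i : ι) : Measurable ((s i).indicator (f i)) := (hf i).indicator (hs i)
  have hind : (Set.univ.pi s).indicator (fun x => ∏ i, f i (x i)) =
      fun x => ∏ i, (s i).indicator (f i) (x i) := by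
    classical
    ext x
    simp only [Set.indicator_apply, Set.mem_univ_pi, Finset.prod_ite_zero, Finset.mem_univ,
      true_imp_iff]
  calc (Measure.pi μ).withDensity (fun x => ∏ i, f i (x i)) (Set.univ.pi s)
      = ∫⁻ x, ∏ i, (s i).indicator (f i) (x i) ∂Measure.pi μ := by
        rw [withDensity_apply _ (MeasurableSet.univ_pi hs),
          ← lintegral_indicator (MeasurableSet.univ_pi hs), hind]
    _ = ∏ i, ∫⁻ x, (s i).indicator (f i) (x i) ∂Measure.pi μ :=
        lintegral_prod_eq_prod_lintegral_of_indepFun Finset.univ _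
          (iIndepFun_pi fun i => (hm i).aemeasurable)
          fun i => (hm i).comp (measurable_pi_apply i)
    _ = ∏ i, (μ i).withDensity (f i) (s i) := by
        congr with i
        rw [(measurePreserving_eval μ i).lintegral_comp (hm i), lintegral_indicator (hs i),
          withDensity_apply _ (hs i)]

/-- The logarithm of the density of `N(c, 1)` with respect to `N(0, 1 + u)`. When `c` is itself
drawn from `N(0, u)`, this compares the joint law of signal and observation with the law under
which the two are independent and have the same marginals. -/
def logRatio (u : ℝ≥0) (c y : ℝ) : ℝ :=
  Real.log (1 + u) / 2 - (y - c) ^ 2 / 2 + y ^ 2 / (2 * (1 + u))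

@[fun_prop]
lemma measurable_logRatio {α : Type*} [MeasurableSpace α] (u : ℝ≥0) {f g : α → ℝ}
    (hf : Measurable f) (hg : Measurable g) : Measurable fun x => logRatio u (f x) (g x) := by
  unfold logRatio
  fun_prop

lemma gaussianReal_eq_withDensity_exp_logRatio (u : ℝ≥0) (c : ℝ) :
    gaussianReal c 1 = (gaussianReal 0 (1 + u)).withDensity
      fun y => ENNReal.ofReal (Real.exp (logRatio u c y)) := by
  have hu : 0 < 1 + (u : ℝ) := by positivity
  rw [gaussianReal_of_var_ne_zero _ one_ne_zero, gaussianReal_of_var_ne_zero _ (by positivity),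
    ← withDensity_mul _ (measurable_gaussianPDF _ _) (by fun_prop)]
  congr with y
  have hsqrt : Real.exp (Real.log (1 + u) / 2) = √(1 + u) := by
    rw [Real.exp_half, Real.exp_log hu]
  have hexp : Real.exp (logRatio u c y) * Real.exp (-y ^ 2 / (2 * (1 + u))) =
      √(1 + u) * Real.exp (-(y - c) ^ 2 / 2) := by
    rw [← hsqrt, ← Real.exp_add, ← Real.exp_add, logRatio]
    ring_nf
  simp only [gaussianPDF, Pi.mul_apply]
  rw [← ENNReal.ofReal_mul (gaussianPDFReal_nonneg _ _ _)]
  simp only [gaussianPDFReal, NNReal.coe_one, NNReal.coe_add, mul_one, sub_zero]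
  rw [mul_assoc, mul_comm (Real.exp (-y ^ 2 / _)), hexp, Real.sqrt_mul (by positivity) (1 + u : ℝ)]
  field_simp

section LogRatio

variable (ι : Type*) [Fintype ι]

/-- The law of a vector with independent coordinates of law `N(0, σ)`. -/
abbrev gauss (σ : ℝ≥0) : Measure (ι → ℝ) :=
  Measure.pi fun _ : ι => gaussianReal 0 σ

variable {ι}

lemma map_const_add_gauss (u : ℝ≥0) (c : ι → ℝ) :
    (gauss ι 1).map (c + ·) = (gauss ι (1 + u)).withDensity
      fun y => ENNReal.ofReal (Real.exp (∑ i, logRatio u (c i) (y i))) := by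
  have htranslate : MeasurePreserving (fun (d : ι → ℝ) i => c i + d i) (gauss ι 1)
      (Measure.pi fun i => gaussianReal (c i) 1) :=
    measurePreserving_pi _ _ fun i =>
      ⟨by fun_prop, by simpa using gaussianReal_map_const_add (μ := 0) (v := 1) (c i)⟩
  have (i : ι) : IsProbabilityMeasure ((gaussianReal 0 (1 + u)).withDensity
      fun y => ENNReal.ofReal (Real.exp (logRatio u (c i) y))) := by
    rw [← gaussianReal_eq_withDensity_exp_logRatio]
    infer_instance
  refine htranslate.map_eq.trans ?_
  simp_rw [gaussianReal_eq_withDensity_exp_logRatio u]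
  rw [pi_withDensity _ fun i => by fun_prop]
  simp_rw [Real.exp_sum, ENNReal.ofReal_prod_of_nonneg fun _ _ => (Real.exp_pos _).le]

variable {X : Type*} [MeasurableSpace X] (ν : Measure X) (u : ℝ≥0) {c : X → ι → ℝ}

lemma map_prod_gauss (hc : Measurable c) :
    (ν.prod (gauss ι 1)).map (fun p => (p.1, c p.1 + p.2)) =
      (ν.prod (gauss ι (1 + u))).withDensity
        fun p => ENNReal.ofReal (Real.exp (∑ i, logRatio u (c p.1 i) (p.2 i))) := by
  ext F hF
  rw [Measure.map_apply (by fun_prop) hF, Measure.prod_apply (hF.preimage (by fun_prop)),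
    withDensity_apply _ hF, ← lintegral_indicator hF,
    lintegral_prod _ (Measurable.indicator (by fun_prop) hF).aemeasurable]
  refine lintegral_congr fun x => ?_
  have hFx : MeasurableSet (Prod.mk x ⁻¹' F) := measurable_prodMk_left hF
  calc gauss ι 1 (Prod.mk x ⁻¹' ((fun p => (p.1, c p.1 + p.2)) ⁻¹' F))
      = (gauss ι 1).map (c x + ·) (Prod.mk x ⁻¹' F) :=
        (Measure.map_apply (by fun_prop) hFx).symm
    _ = _ := by
      rw [map_const_add_gauss u, withDensity_apply _ hFx, ← lintegral_indicator hFx]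
      rfl

lemma logRatio_add (c d : ℝ) :
    logRatio u c (c + d) = Real.log (1 + u) / 2 + (1 / (2 * (1 + u)) * c ^ 2 +
      -u / (2 * (1 + u)) * d ^ 2 + 1 / (1 + u) * (c * d)) := by
  have : 1 + (u : ℝ) ≠ 0 := by positivity
  unfold logRatio
  field_simp
  ring

lemma memLp_logRatio_add :
    MemLp (fun p : ℝ × ℝ => logRatio u p.1 (p.1 + p.2)) 2
      ((gaussianReal 0 u).prod (gaussianReal 0 1)) := by
  simp only [logRatio_add]
  exact (memLp_const (Real.log (1 + u) / 2)).add
    (memLp_quadraticForm u 1 (1 / (2 * (1 + u))) (-u / (2 * (1 + u))) (1 / (1 + u)))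

lemma integral_logRatio_add :
    ∫ p : ℝ × ℝ, logRatio u p.1 (p.1 + p.2) ∂((gaussianReal 0 u).prod (gaussianReal 0 1)) =
      Real.log (1 + u) / 2 := by
  simp only [logRatio_add]
  rw [integral_add (integrable_const _) ((memLp_quadraticForm u 1 _ _ _).integrable one_le_two),
    integral_quadraticForm]
  simp only [integral_const, probReal_univ, one_smul, NNReal.coe_one]
  field_simp
  ring

lemma variance_logRatio_add :
    Var[fun p : ℝ × ℝ => logRatio u p.1 (p.1 + p.2);
      (gaussianReal 0 u).prod (gaussianReal 0 1)] = u / (1 + u) := by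
  have : 1 + (u : ℝ) ≠ 0 := by positivity
  simp only [logRatio_add]
  rw [variance_const_add (by fun_prop), variance_quadraticForm]
  simp only [NNReal.coe_one]
  field_simp
  ring

end LogRatio

section ChangeOfMeasure

variable {ι : Type*} [Fintype ι]

lemma measure_lt_sum_logRatio_le (u : ℝ≥0) {τ : ℝ} (hτ : Fintype.card ι * u / 2 < τ) :
    ((gauss ι u).prod (gauss ι 1)) {p | τ < ∑ i, logRatio u (p.1 i) (p.1 i + p.2 i)} ≤
      ENNReal.ofReal (Fintype.card ι * u / (τ - Fintype.card ι * u / 2) ^ 2) := by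
  rw [← (measurePreserving_arrowProdEquivProdArrow ℝ ℝ ι (fun _ => gaussianReal 0 u)
    fun _ => gaussianReal 0 1).measure_preimage_equiv]
  set P := Measure.pi fun _ : ι => (gaussianReal 0 u).prod (gaussianReal 0 1)
  let R (i : ι) (q : ι → ℝ × ℝ) : ℝ := logRatio u (q i).1 ((q i).1 + (q i).2)
  have hmem (i : ι) : MemLp (R i) 2 P :=
    (memLp_logRatio_add u).comp_measurePreserving (measurePreserving_eval _ i)
  have hmean : P[∑ i, R i] ≤ Fintype.card ι * (u : ℝ) / 2 := by
    have hcoord (i : ι) : ∫ q, R i q ∂P = Real.log (1 + u) / 2 :=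
      (integral_comp_eval (μ := fun _ : ι => (gaussianReal 0 u).prod (gaussianReal 0 1))
        (memLp_logRatio_add u).aestronglyMeasurable).trans (integral_logRatio_add u)
    have hlog : Real.log (1 + u) ≤ u := by
      linarith [Real.log_le_sub_one_of_pos (show 0 < 1 + (u : ℝ) by positivity)]
    calc P[∑ i, R i] = Fintype.card ι * (Real.log (1 + u) / 2) := by
          simp only [Finset.sum_apply]
          rw [integral_finsetSum _ fun i _ => (hmem i).integrable one_le_two]
          simp [hcoord]
      _ ≤ Fintype.card ι * u / 2 := by rw [mul_div_assoc]; gcongr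
  have hvar : Var[∑ i, R i; P] ≤ Fintype.card ι * (u : ℝ) := by
    have hdiv : (u : ℝ) / (1 + u) ≤ u := div_le_self u.2 (by linarith [u.2])
    calc Var[∑ i, R i; P] = Fintype.card ι * (u / (1 + u)) := by
          rw [variance_sum_pi fun _ => memLp_logRatio_add u]
          simp [variance_logRatio_add]
      _ ≤ Fintype.card ι * u := by gcongr
  refine (measure_mono fun q (hq : τ < ∑ i, R i q) => ?_).trans
    ((meas_ge_le_variance_div_sq (memLp_finsetSum' Finset.univ fun i _ => hmem i)
      (sub_pos.2 hτ)).trans (ENNReal.ofReal_le_ofReal (by gcongr)))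
  rw [Set.mem_ofPred_eq, Finset.sum_apply]
  exact le_trans (by linarith) (le_abs_self _)

-- The second term is the mass, under the true law, of the event that the density exceeds `exp τ`.
theorem measure_prod_gauss_le {X : Type*} [MeasurableSpace X] {ν : Measure X} [SFinite ν] {u : ℝ≥0}
    {c : X → ι → ℝ} (hc : MeasurePreserving c ν (gauss ι u)) {τ : ℝ}
    (hτ : Fintype.card ι * u / 2 < τ) {F : Set (X × (ι → ℝ))} (hF : MeasurableSet F) :
    (ν.prod (gauss ι 1)) {p | (p.1, c p.1 + p.2) ∈ F} ≤
      ENNReal.ofReal (Real.exp τ) * (ν.prod (gauss ι (1 + u))) F +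
        ENNReal.ofReal (Fintype.card ι * u / (τ - Fintype.card ι * u / 2) ^ 2) := by
  have hcm : Measurable c := hc.measurable
  have hmap (G : Set (X × (ι → ℝ))) (hG : MeasurableSet G) :
      (ν.prod (gauss ι (1 + u))).withDensity
        (fun p => ENNReal.ofReal (Real.exp (∑ i, logRatio u (c p.1 i) (p.2 i)))) G =
        (ν.prod (gauss ι 1)) {p | (p.1, c p.1 + p.2) ∈ G} := by
    rw [← map_prod_gauss ν u hcm, Measure.map_apply (by fun_prop) hG]
    rfl
  rw [← hmap F hF]
  refine (withDensity_apply_le_mul_add _ (by fun_prop) (ENNReal.ofReal (Real.exp τ)) hF).trans ?_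
  gcongr
  rw [hmap _ (measurableSet_lt measurable_const (by fun_prop))]
  have hlt : MeasurableSet {p : (ι → ℝ) × (ι → ℝ) |
      τ < ∑ i, logRatio u (p.1 i) (p.1 i + p.2 i)} :=
    measurableSet_lt measurable_const (by fun_prop)
  refine le_trans (le_of_eq ?_) (measure_lt_sum_logRatio_le u hτ)
  rw [← (hc.prod (MeasurePreserving.id (gauss ι 1))).measure_preimage hlt.nullMeasurableSet]
  congr with p
  simp [ENNReal.ofReal_lt_ofReal_iff, Real.exp_pos]

end ChangeOfMeasure

lemma exists_measure_le_inv_card {ι Ω : Type*} [Fintype ι] [Nonempty ι] [MeasurableSpace Ω]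
    (μ : Measure Ω) [IsProbabilityMeasure μ] {E : ι → Set Ω} (hE : ∀ i, MeasurableSet (E i))
    (hdisj : Pairwise (Function.onFun Disjoint E)) : ∃ i, μ (E i) ≤ (Fintype.card ι : ℝ≥0∞)⁻¹ := by
  have hsum : ∑ i, μ (E i) ≤ ∑ _ : ι, (Fintype.card ι : ℝ≥0∞)⁻¹ := by
    rw [← tsum_fintype (L := .unconditional _), ← measure_iUnion hdisj hE, Finset.sum_const,
      nsmul_eq_mul, Finset.card_univ, ENNReal.mul_inv_cancel (by simp) (by simp)]
    exact prob_le_one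
  obtain ⟨i, -, hi⟩ := ENNReal.exists_le_of_sum_le Finset.univ_nonempty hsum
  exact ⟨i, hi⟩

section Argmax

variable {ι α : Type*} [Fintype ι] [MeasurableSpace α] (μ : Measure α) [IsProbabilityMeasure μ]
  {s : α → ℝ}

lemma measure_forall_ne_lt_le (hs : Measurable s) (i : ι) :
    Measure.pi (fun _ : ι => μ) {g | ∀ l, l ≠ i → s (g l) < s (g i)} ≤
      (Fintype.card ι : ℝ≥0∞)⁻¹ := by
  classical
  let E (j : ι) : Set (ι → α) := {g | ∀ l, l ≠ j → s (g l) < s (g j)}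
  have hE (j : ι) : MeasurableSet (E j) := by
    simp only [E, Set.ofPred_forall]
    exact MeasurableSet.iInter fun l => MeasurableSet.iInter fun _ =>
      measurableSet_lt (by fun_prop) (by fun_prop)
  have hsame (j : ι) : Measure.pi (fun _ : ι => μ) (E j) = Measure.pi (fun _ : ι => μ) (E i) := by
    have hperm := measurePreserving_arrowCongr' (fun _ : ι => μ) (fun _ => μ) (Equiv.swap i j)
      (MeasurableEquiv.refl α) (fun _ => MeasurePreserving.id _)
    rw [← hperm.measure_preimage (hE i).nullMeasurableSet]
    congr with g
    change (∀ l, _) ↔ ∀ l, l ≠ i → s (g (Equiv.swap i j l)) < s (g (Equiv.swap i j i))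
    rw [(Equiv.swap i j).surjective.forall]
    simp [Equiv.swap_apply_eq_iff]
  have hdisj : Pairwise (Function.onFun Disjoint E) := fun a b hab =>
    Set.disjoint_left.2 fun g ha hb => lt_asymm (ha b hab.symm) (hb a hab)
  have : Nonempty ι := ⟨i⟩
  obtain ⟨j, hj⟩ := exists_measure_le_inv_card (Measure.pi fun _ : ι => μ) hE hdisj
  exact (hsame j).symm.trans_le hj

lemma ae_apply_ne_apply (hs : Measurable s) (hne : ∀ c, ∀ᵐ g ∂μ, s g ≠ c) {i l : ι} (hl : l ≠ i) :
    ∀ᵐ g ∂Measure.pi fun _ : ι => μ, s (g l) ≠ s (g i) := by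
  have hset : MeasurableSet {q : α × α | s q.2 ≠ s q.1} :=
    (measurableSet_eq_fun (by fun_prop) (by fun_prop)).compl
  have hindep : IndepFun (fun g => g i) (fun g => g l) (Measure.pi fun _ : ι => μ) :=
    (iIndepFun_pi (X := fun _ => id) fun _ => aemeasurable_id).indepFun hl.symm
  have hpair : (Measure.pi fun _ : ι => μ).map (fun g => (g i, g l)) = μ.prod μ := by
    rw [(indepFun_iff_map_prod_eq_prod_map_map (measurable_pi_apply i).aemeasurable
      (measurable_pi_apply l).aemeasurable).1 hindep]
    exact congrArg₂ Measure.prod (measurePreserving_eval (fun _ : ι => μ) i).map_eq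
      (measurePreserving_eval (fun _ : ι => μ) l).map_eq
  have hae : ∀ᵐ q ∂(Measure.pi fun _ : ι => μ).map (fun g => (g i, g l)), s q.2 ≠ s q.1 := by
    rw [hpair]
    exact (Measure.ae_prod_iff_ae_ae hset).2 (ae_of_all _ fun g => hne (s g))
  exact ae_of_ae_map
    (by fun_prop : Measurable fun g : ι → α => (g i, g l)).aemeasurable hae

lemma measure_forall_le_le (hs : Measurable s) (hne : ∀ c, ∀ᵐ g ∂μ, s g ≠ c) (i : ι) :
    Measure.pi (fun _ : ι => μ) {g | ∀ l, s (g l) ≤ s (g i)} ≤ (Fintype.card ι : ℝ≥0∞)⁻¹ := by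
  refine (measure_mono_ae ?_).trans (measure_forall_ne_lt_le μ hs i)
  have hall : ∀ᵐ g ∂Measure.pi fun _ : ι => μ, ∀ l, l ≠ i → s (g l) ≠ s (g i) :=
    ae_all_iff.2 fun l => eventually_imp_distrib_left.2 (ae_apply_ne_apply μ hs hne)
  filter_upwards [hall] with g hg hle l hl
  exact (hle l).lt_of_ne (hg l hl)

end Argmax

section NullSets

lemma ae_mem_of_polynomial_eval_ne_zero {E : Type*} [NormedAddCommGroup E] [NormedSpace ℝ E]
    [FiniteDimensional ℝ E] [MeasurableSpace E] [BorelSpace E] (ν : Measure E) [ν.IsAddHaarMeasure]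
    {s : Set E} (hs : MeasurableSet s) (e : E) {p : E → Polynomial ℝ} (hp : ∀ x, p x ≠ 0)
    (h : ∀ x t, (p x).eval t ≠ 0 → x + t • e ∈ s) : ∀ᵐ x ∂ν, x ∈ s := by
  refine ae_mem_of_ae_add_linearMap_mem (LinearMap.toSpanSingleton ℝ E e) volume ν hs fun x => ?_
  have hroots : ∀ᵐ t : ℝ, ¬ (p x).IsRoot t := by
    rw [ae_iff]
    simpa using (Polynomial.finite_setOfPred_isRoot (hp x)).measure_zero volume
  filter_upwards [hroots] with t ht using h x t ht

lemma pi_fin_absolutelyContinuous {α : Type*} [MeasurableSpace α] {μ ν : Measure α}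
    [SigmaFinite μ] [SigmaFinite ν] (h : μ ≪ ν) (r : ℕ) :
    Measure.pi (fun _ : Fin r => μ) ≪ Measure.pi fun _ : Fin r => ν := by
  induction r with
  | zero => rw [Measure.pi_of_empty _ isEmptyElim, Measure.pi_of_empty _ isEmptyElim]
  | succ r ih =>
    let e := MeasurableEquiv.piFinSuccAbove (fun _ : Fin (r + 1) => α) 0
    have hμ := (measurePreserving_piFinSuccAbove (fun _ : Fin (r + 1) => μ) 0).symm e
    have hν := (measurePreserving_piFinSuccAbove (fun _ : Fin (r + 1) => ν) 0).symm e
    rw [← hμ.map_eq, ← hν.map_eq]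
    exact (h.prod ih).map e.symm.measurable

lemma pi_absolutelyContinuous {ι α : Type*} [Fintype ι] [MeasurableSpace α] {μ ν : Measure α}
    [SigmaFinite μ] [SigmaFinite ν] (h : μ ≪ ν) :
    Measure.pi (fun _ : ι => μ) ≪ Measure.pi fun _ : ι => ν := by
  have hreindex (ρ : Measure α) [SigmaFinite ρ] :=
    (measurePreserving_arrowCongr' (fun _ => ρ) (fun _ => ρ) (Fintype.equivFin ι).symm
      (MeasurableEquiv.refl α) fun _ => MeasurePreserving.id _).map_eq
  rw [← hreindex μ, ← hreindex ν]
  exact (pi_fin_absolutelyContinuous h _).map (MeasurableEquiv.measurable _)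

lemma gauss_absolutelyContinuous (ι : Type*) [Fintype ι] {σ : ℝ≥0} (hσ : σ ≠ 0) :
    gauss ι σ ≪ volume :=
  pi_absolutelyContinuous (gaussianReal_absolutelyContinuous 0 hσ)

lemma exists_sq_dotProduct_ne {ι : Type*} [Fintype ι] [Nontrivial ι] {y : ι → ℝ} (hy : y ≠ 0)
    (c : ℝ) : ∃ e : ι → ℝ, (e ⬝ᵥ y) ^ 2 - c * (e ⬝ᵥ e) ≠ 0 := by
  classical
  have hyy : y ⬝ᵥ y ≠ 0 := mt dotProduct_self_eq_zero.1 hy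
  rcases eq_or_ne c (y ⬝ᵥ y) with rfl | hc
  · obtain ⟨a, ha⟩ : ∃ a, y a ≠ 0 := Function.ne_iff.1 hy
    obtain ⟨b, hb⟩ := exists_ne a
    let e : ι → ℝ := y b • Pi.single a 1 - y a • Pi.single b 1
    have horth : e ⬝ᵥ y = 0 := by
      simp only [e, sub_dotProduct, smul_dotProduct, single_dotProduct, smul_eq_mul]
      ring
    have he : e ≠ 0 := fun h => ha (by simpa [e, hb.symm, hb] using congrFun h b)
    refine ⟨e, ?_⟩
    simpa [horth] using ⟨hy, he⟩
  · refine ⟨y, ?_⟩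
    rw [sq, ← sub_mul]
    exact mul_ne_zero (sub_ne_zero.2 hc.symm) hyy

lemma ae_sq_dotProduct_ne {ι : Type*} [Fintype ι] [Nontrivial ι] {σ : ℝ≥0} (hσ : σ ≠ 0)
    {y : ι → ℝ} (hy : y ≠ 0) (c : ℝ) : ∀ᵐ g ∂gauss ι σ, (g ⬝ᵥ y) ^ 2 ≠ c * (g ⬝ᵥ g) := by
  obtain ⟨e, he⟩ := exists_sq_dotProduct_ne hy c
  let p (g : ι → ℝ) : Polynomial ℝ :=
    .C ((e ⬝ᵥ y) ^ 2 - c * (e ⬝ᵥ e)) * .X ^ 2 +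
      .C (2 * ((g ⬝ᵥ y) * (e ⬝ᵥ y) - c * (g ⬝ᵥ e))) * .X + .C ((g ⬝ᵥ y) ^ 2 - c * (g ⬝ᵥ g))
  have hp (g : ι → ℝ) : p g ≠ 0 :=
    Polynomial.leadingCoeff_ne_zero.1 (by rwa [Polynomial.leadingCoeff_quadratic he])
  refine (gauss_absolutelyContinuous ι hσ).ae_le <|
    ae_mem_of_polynomial_eval_ne_zero volume (s := {g | (g ⬝ᵥ y) ^ 2 ≠ c * (g ⬝ᵥ g)})
      (measurableSet_eq_fun ?_ ?_).compl e hp fun g t ht heq => ht ?_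
  · unfold dotProduct; fun_prop
  · unfold dotProduct; fun_prop
  · simp only [add_dotProduct, dotProduct_add, smul_dotProduct, dotProduct_smul, smul_eq_mul,
      dotProduct_comm e g] at heq
    simp only [p, Polynomial.eval_add, Polynomial.eval_mul, Polynomial.eval_C, Polynomial.eval_pow,
      Polynomial.eval_X]
    linear_combination heq

lemma ae_linearIndependent_comp {ι κ o : Type*} [Fintype ι] [Fintype κ] [Fintype o] {σ : ℝ≥0}
    (hσ : σ ≠ 0) (h : κ ↪ o) (hcard : Fintype.card κ ≤ Fintype.card ι) :
    ∀ᵐ g ∂Measure.pi fun _ : o => gauss ι σ, LinearIndependent ℝ (g ∘ h) := by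
  classical
  obtain ⟨f⟩ : Nonempty (κ ↪ ι) := Function.Embedding.nonempty_of_card_le hcard
  let E : o → ι → ℝ := Function.extend h (fun j => Pi.single (f j) 1) 0
  have hE (j : κ) : E (h j) = Pi.single (f j) 1 := h.injective.extend_apply _ _ j
  -- Moving `g` by `t • E` adds `t` times the identity to the minor `B g`.
  let B (g : o → ι → ℝ) : Matrix κ κ ℝ := Matrix.of fun j j' => g (h j) (f j')
  have hcont : Continuous fun g : o → ι → ℝ => g ∘ h :=
    continuous_pi fun j => continuous_apply (h j)
  refine (pi_absolutelyContinuous (gauss_absolutelyContinuous ι hσ)).ae_le <|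
    ae_mem_of_polynomial_eval_ne_zero volume (s := {g | LinearIndependent ℝ (g ∘ h)})
      (isOpen_setOfPred_linearIndependent.preimage hcont).measurableSet E
      (fun g => (Matrix.charpoly_monic (-B g)).ne_zero) fun g t ht => ?_
  rw [Matrix.eval_charpoly] at ht
  have hminor : LinearMap.funLeft ℝ ℝ f ∘ (g + t • E) ∘ h =
      fun j => (Matrix.scalar κ t - -B g) j := by
    ext j j'
    simp [hE, B, LinearMap.funLeft_apply, Matrix.scalar_apply, Matrix.diagonal_apply,
      Pi.single_apply, add_comm, eq_comm]
  refine LinearIndependent.of_comp (LinearMap.funLeft ℝ ℝ f) ?_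
  exact hminor ▸ Matrix.linearIndependent_rows_of_det_ne_zero ht

end NullSets

section Score

variable {κ ι : Type*} [Fintype κ] [Fintype ι]

/-- The squared length of the projection of `y` onto the line through `g`; it is `0` for `g = 0`. -/
def score (g y : κ → ℝ) : ℝ :=
  (g ⬝ᵥ y) ^ 2 / (g ⬝ᵥ g)

@[fun_prop]
lemma measurable_score {α : Type*} [MeasurableSpace α] {f g : α → κ → ℝ} (hf : Measurable f)
    (hg : Measurable g) : Measurable fun a => score (f a) (g a) := by
  unfold score dotProduct
  fun_prop

lemma score_mul_dotProduct_self (g y : κ → ℝ) : score g y * (g ⬝ᵥ g) = (g ⬝ᵥ y) ^ 2 := by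
  rcases eq_or_ne g 0 with rfl | hg
  · simp
  · exact div_mul_cancel₀ _ (mt dotProduct_self_eq_zero.1 hg)

lemma ae_score_ne [Nontrivial κ] {σ : ℝ≥0} (hσ : σ ≠ 0) {y : κ → ℝ} (hy : y ≠ 0) (c : ℝ) :
    ∀ᵐ g ∂gauss κ σ, score g y ≠ c := by
  filter_upwards [ae_sq_dotProduct_ne hσ hy c] with g hg hc
  exact hg (by rw [← hc, score_mul_dotProduct_self])

lemma ae_gauss_ne_zero [Nontrivial κ] {σ : ℝ≥0} (hσ : σ ≠ 0) : ∀ᵐ g ∂gauss κ σ, g ≠ 0 := by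
  filter_upwards [ae_sq_dotProduct_ne hσ (one_ne_zero : (1 : κ → ℝ) ≠ 0) 0] with g hg h
  simp [h] at hg

lemma measurePreserving_smul_gauss {σ u : ℝ≥0} {v : ℝ} (hu : (u : ℝ) = v ^ 2 * σ) :
    MeasurePreserving (fun g : κ → ℝ => v • g) (gauss κ σ) (gauss κ u) := by
  have hvar : u = .mk (v ^ 2) (sq_nonneg v) * σ := NNReal.eq hu
  refine measurePreserving_pi (f := fun _ x => v * x) _ _ fun _ => ⟨by fun_prop, ?_⟩
  rw [gaussianReal_map_const_mul, mul_zero, hvar]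

variable {σ u : ℝ≥0} {v : ℝ} (hu : (u : ℝ) = v ^ 2 * σ) (i : ι) {τ : ℝ}
  (hτ : Fintype.card κ * u / 2 < τ)

include hu hτ

theorem measure_scores_mem_le {S : Set (ι → ℝ)} (hS : MeasurableSet S) {ε : ℝ≥0∞}
    (hε : ∀ᵐ y ∂gauss κ (1 + u), (Measure.pi fun _ : ι => gauss κ σ)
      {g | (fun l => score (g l) y) ∈ S} ≤ ε) :
    ((Measure.pi fun _ : ι => gauss κ σ).prod (gauss κ 1))
        {p | (fun l => score (p.1 l) (v • p.1 i + p.2)) ∈ S} ≤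
      ENNReal.ofReal (Real.exp τ) * ε +
        ENNReal.ofReal (Fintype.card κ * u / (τ - Fintype.card κ * u / 2) ^ 2) := by
  have hF : MeasurableSet {p : (ι → κ → ℝ) × (κ → ℝ) | (fun l => score (p.1 l) p.2) ∈ S} :=
    hS.preimage (by fun_prop)
  refine (measure_prod_gauss_le ((measurePreserving_smul_gauss hu).comp
    (measurePreserving_eval (fun _ : ι => gauss κ σ) i)) hτ hF).trans ?_
  gcongr
  rw [Measure.prod_apply_symm hF]
  exact (lintegral_mono_ae hε).trans (by simp)

lemma measure_score_lt_le :
    ((Measure.pi fun _ : ι => gauss κ σ).prod (gauss κ 1))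
        {p | ∀ l, l ≠ i → score (p.1 l) (v • p.1 i + p.2) < score (p.1 i) (v • p.1 i + p.2)} ≤
      ENNReal.ofReal (Real.exp τ) * (Fintype.card ι : ℝ≥0∞)⁻¹ +
        ENNReal.ofReal (Fintype.card κ * u / (τ - Fintype.card κ * u / 2) ^ 2) := by
  refine measure_scores_mem_le hu i hτ (S := {r | ∀ l, l ≠ i → r l < r i}) ?_ ?_
  · simp only [Set.ofPred_forall]
    exact MeasurableSet.iInter fun l => MeasurableSet.iInter fun _ =>
      measurableSet_lt (by fun_prop) (by fun_prop)
  · exact ae_of_all _ fun y => measure_forall_ne_lt_le (gauss κ σ) (s := (score · y))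
      (by fun_prop) i

lemma measure_score_le_le [Nontrivial κ] (hσ : σ ≠ 0) :
    ((Measure.pi fun _ : ι => gauss κ σ).prod (gauss κ 1))
        {p | ∀ l, score (p.1 l) (v • p.1 i + p.2) ≤ score (p.1 i) (v • p.1 i + p.2)} ≤
      ENNReal.ofReal (Real.exp τ) * (Fintype.card ι : ℝ≥0∞)⁻¹ +
        ENNReal.ofReal (Fintype.card κ * u / (τ - Fintype.card κ * u / 2) ^ 2) := by
  refine measure_scores_mem_le hu i hτ (S := {r | ∀ l, r l ≤ r i}) ?_ ?_
  · simp only [Set.ofPred_forall]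
    exact MeasurableSet.iInter fun l => measurableSet_le (by fun_prop) (by fun_prop)
  · filter_upwards [ae_gauss_ne_zero (κ := κ) (σ := 1 + u) (by positivity)] with y hy
    exact measure_forall_le_le (gauss κ σ) (s := (score · y)) (by fun_prop) (ae_score_ne hσ hy) i

end Score

section Projection

variable {E : Type*} [NormedAddCommGroup E] [InnerProductSpace ℝ E] [FiniteDimensional ℝ E]

lemma inner_starProjection_self (V : Submodule ℝ E) (y : E) :
    inner ℝ (V.starProjection y) y = ‖V.starProjection y‖ ^ 2 := by
  rw [← real_inner_self_eq_norm_sq, V.inner_starProjection_left_eq_right _ (V.starProjection y),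
    V.starProjection_eq_self_iff.2 (V.starProjection_apply_mem y), real_inner_comm]

lemma lt_norm_sq_starProjection_iff (V : Submodule ℝ E) (y : E) (t : ℝ) :
    t < ‖V.starProjection y‖ ^ 2 ↔ ∃ w ∈ V, t < 2 * inner ℝ w y - ‖w‖ ^ 2 := by
  constructor
  · intro ht
    refine ⟨V.starProjection y, V.starProjection_apply_mem y, ?_⟩
    rw [inner_starProjection_self]
    linarith
  · rintro ⟨w, hw, ht⟩
    have hinner : inner ℝ w y = inner ℝ w (V.starProjection y) := by
      rw [← V.inner_starProjection_left_eq_right, V.starProjection_eq_self_iff.2 hw]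
    have hsq := norm_sub_sq_real w (V.starProjection y)
    linarith [sq_nonneg ‖w - V.starProjection y‖]

lemma starProjection_sup_of_isOrtho {U V : Submodule ℝ E} (h : U ⟂ V) (y : E) :
    (U ⊔ V).starProjection y = U.starProjection y + V.starProjection y := by
  refine Submodule.eq_starProjection_of_mem_orthogonal
    (add_mem (Submodule.mem_sup_left (U.starProjection_apply_mem y))
      (Submodule.mem_sup_right (V.starProjection_apply_mem y))) ?_
  rw [← Submodule.inf_orthogonal]
  constructor
  · rw [← sub_sub]
    exact sub_mem (U.sub_starProjection_mem_orthogonal y) (h.symm (V.starProjection_apply_mem y))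
  · rw [add_comm, ← sub_sub]
    exact sub_mem (V.sub_starProjection_mem_orthogonal y) (h (U.starProjection_apply_mem y))

lemma sup_span_starProjection_orthogonal (W : Submodule ℝ E) (w : E) :
    W ⊔ Submodule.span ℝ {Wᗮ.starProjection w} = W ⊔ Submodule.span ℝ {w} := by
  have hw : Wᗮ.starProjection w = w - W.starProjection w :=
    Submodule.starProjection_orthogonal_val w
  have hW := W.starProjection_apply_mem w
  refine le_antisymm (sup_le le_sup_left ?_) (sup_le le_sup_left ?_) <;>
    rw [Submodule.span_singleton_le_iff_mem]
  · rw [hw]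
    exact sub_mem (Submodule.mem_sup_right (Submodule.mem_span_singleton_self w))
      (Submodule.mem_sup_left hW)
  · have hq : Wᗮ.starProjection w ∈ W ⊔ Submodule.span ℝ {Wᗮ.starProjection w} :=
      Submodule.mem_sup_right (Submodule.mem_span_singleton_self _)
    simpa only [hw, sub_add_cancel] using add_mem hq (Submodule.mem_sup_left hW)

lemma norm_sq_starProjection_sup_span (W : Submodule ℝ E) (w y : E) :
    ‖(W ⊔ Submodule.span ℝ {w}).starProjection y‖ ^ 2 = ‖W.starProjection y‖ ^ 2 +
      inner ℝ (Wᗮ.starProjection w) y ^ 2 / ‖Wᗮ.starProjection w‖ ^ 2 := by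
  set q := Wᗮ.starProjection w
  have hortho : W ⟂ Submodule.span ℝ {q} := by
    rw [Submodule.isOrtho_comm, Submodule.isOrtho_iff_le, Submodule.span_singleton_le_iff_mem]
    exact Submodule.starProjection_apply_mem _ _
  have hproj : ((W ⊔ Submodule.span ℝ {w}).starProjection y : E) =
      W.starProjection y + (Submodule.span ℝ {q}).starProjection y := by
    simp only [← sup_span_starProjection_orthogonal W w]
    exact starProjection_sup_of_isOrtho hortho y
  have hinner := Submodule.isOrtho_iff_inner_eq.1 hortho _ (W.starProjection_apply_mem y) _
    ((Submodule.span ℝ {q}).starProjection_apply_mem y)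
  have hline : ‖(Submodule.span ℝ {q}).starProjection y‖ ^ 2 = inner ℝ q y ^ 2 / ‖q‖ ^ 2 := by
    rw [← inner_starProjection_self, Submodule.starProjection_singleton, inner_smul_left]
    simp [sq, div_mul_eq_mul_div]
  rw [hproj, norm_add_sq_real, hinner, hline, mul_zero, add_zero]

lemma starProjection_span_range_eq_sum {κ : Type*} [Fintype κ] {v : κ → E}
    (hv : Orthonormal ℝ v) (x : E) :
    (Submodule.span ℝ (Set.range v)).starProjection x = ∑ a, inner ℝ (v a) x • v a := by
  have hmem : ∑ a, inner ℝ (v a) x • v a ∈ Submodule.span ℝ (Set.range v) :=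
    sum_mem fun a _ => Submodule.smul_mem _ _ (Submodule.subset_span (Set.mem_range_self a))
  refine Submodule.eq_starProjection_of_mem_of_inner_eq_zero hmem fun w hw => ?_
  induction hw using Submodule.span_induction with
  | mem w hw =>
    obtain ⟨a, rfl⟩ := hw
    rw [inner_sub_left, hv.inner_left_fintype, real_inner_comm]
    simp
  | zero => simp
  | add w z _ _ hw hz => rw [inner_add_right, hw, hz, add_zero]
  | smul r w _ hw => rw [inner_smul_right, hw, mul_zero]

lemma exists_orthonormal_span_eq {V : Submodule ℝ E} {M : ℕ} (hV : Module.finrank ℝ V = M) :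
    ∃ v : Fin M → E, Orthonormal ℝ v ∧ Submodule.span ℝ (Set.range v) = V := by
  subst hV
  let b := stdOrthonormalBasis ℝ V
  refine ⟨fun a => b a, b.orthonormal.comp_linearIsometry V.subtypeₗᵢ, ?_⟩
  rw [show (fun a => (b a : E)) = V.subtype ∘ b from rfl, Set.range_comp, Submodule.span_image,
    ← b.coe_toBasis, b.toBasis.span_eq, Submodule.map_top, Submodule.range_subtype]

end Projection

section Coords

variable {ι κ : Type*} [Fintype ι]

/-- The inner products of `x` with the vectors `v a`; when these are orthonormal, they are the
coordinates of the projection of `x` onto the span of the `v a`. -/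
def coords (v : κ → EuclideanSpace ℝ ι) (x : ι → ℝ) : κ → ℝ :=
  fun a => inner ℝ (v a) (WithLp.toLp 2 x)

@[fun_prop]
lemma measurable_coords (v : κ → EuclideanSpace ℝ ι) : Measurable (coords v) := by
  unfold coords
  fun_prop

variable [Fintype κ]

lemma charFun_gauss (σ : ℝ≥0) (t : EuclideanSpace ℝ ι) :
    charFun ((gauss ι σ).map (WithLp.toLp 2)) t = Complex.exp (-(σ * ‖t‖ ^ 2 / 2 : ℝ)) := by
  simp [charFun_pi, charFun_gaussianReal, ← Complex.exp_sum, EuclideanSpace.real_norm_sq_eq,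
    Finset.mul_sum, Finset.sum_div]

lemma measurePreserving_coords (σ : ℝ≥0) {v : κ → EuclideanSpace ℝ ι} (hv : Orthonormal ℝ v) :
    MeasurePreserving (coords v) (gauss ι σ) (gauss κ σ) := by
  have hm := measurable_coords v
  refine ⟨hm, ?_⟩
  have : IsProbabilityMeasure ((gauss ι σ).map (coords v)) :=
    Measure.isProbabilityMeasure_map hm.aemeasurable
  refine charFun_eq_pi_iff.1 fun t => ?_
  have hchar : charFun (((gauss ι σ).map (coords v)).map (WithLp.toLp 2)) t =
      charFun ((gauss ι σ).map (WithLp.toLp 2)) (∑ a, t a • v a) := by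
    simp only [charFun, ← MeasurableEquiv.coe_toLp, integral_map_equiv]
    rw [integral_map hm.aemeasurable (by fun_prop)]
    congr with x
    congr 3
    simp [inner_sum, inner_smul_right, PiLp.inner_apply, coords, mul_comm]
  have hnorm : ‖∑ a, t a • v a‖ ^ 2 = ‖t‖ ^ 2 := by
    rw [← real_inner_self_eq_norm_sq, hv.inner_sum, EuclideanSpace.real_norm_sq_eq]
    simp [sq]
  rw [hchar, charFun_gauss, hnorm, ← charFun_pi, charFun_gauss]

lemma coords_dotProduct_coords {v : κ → EuclideanSpace ℝ ι} (hv : Orthonormal ℝ v) (x y : ι → ℝ) :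
    coords v x ⬝ᵥ coords v y = inner ℝ
      ((Submodule.span ℝ (Set.range v)).starProjection (WithLp.toLp 2 x)) (WithLp.toLp 2 y) := by
  rw [starProjection_span_range_eq_sum hv, sum_inner]
  simp [coords, dotProduct, inner_smul_left]

end Coords

section Swap

variable {ι κ : Type*} [Fintype ι] [Fintype κ]

lemma measurePreserving_curry_pi (μ : Measure ℝ) [IsProbabilityMeasure μ] :
    MeasurePreserving (MeasurableEquiv.curry ι κ ℝ) (Measure.pi fun _ => μ)
      (Measure.pi fun _ => Measure.pi fun _ => μ) :=
  ⟨MeasurableEquiv.measurable _, by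
    simpa only [Measure.infinitePi_eq_pi] using
      Measure.infinitePi_map_curry (ι := ι) (κ := κ) fun _ _ => μ⟩

lemma measurePreserving_swap_pi (μ : Measure ℝ) [IsProbabilityMeasure μ] :
    MeasurePreserving (fun (A : ι → κ → ℝ) j i => A i j)
      (Measure.pi fun _ => Measure.pi fun _ => μ) (Measure.pi fun _ => Measure.pi fun _ => μ) :=
  (measurePreserving_curry_pi μ).comp ((measurePreserving_piCongrLeft (fun _ : κ × ι => μ)
    (Equiv.prodComm ι κ)).comp ((measurePreserving_curry_pi μ).symm _))

end Swap

section Columns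

variable {m n : ℕ}

/-- The increase of the energy when the index `j` is added to the set `K`. -/
def gain (A : Fin m → Fin n → ℝ) (y : EuclideanSpace ℝ (Fin m)) (K : Finset (Fin n))
    (j : Fin n) : ℝ :=
  energy A y (insert j K) - energy A y K

lemma lt_energy_iff (A : Fin m → Fin n → ℝ) (y : EuclideanSpace ℝ (Fin m))
    (J : Finset (Fin n)) (t : ℝ) :
    t < energy A y J ↔ ∃ c : Fin n → ℝ,
      t < 2 * inner ℝ (∑ j ∈ J, c j • WithLp.toLp 2 fun i => A i j) y -
        ‖∑ j ∈ J, c j • (WithLp.toLp 2 fun i => A i j : EuclideanSpace ℝ (Fin m))‖ ^ 2 := by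
  simp only [energy, lt_norm_sq_starProjection_iff, colSpan,
    Submodule.mem_span_image_finset_iff_exists_fun']
  constructor
  · rintro ⟨_, ⟨c, rfl⟩, hc⟩
    exact ⟨c, hc⟩
  · rintro ⟨c, hc⟩
    exact ⟨_, ⟨c, rfl⟩, hc⟩

@[fun_prop]
lemma measurable_energy {α : Type*} [MeasurableSpace α] {A : α → Fin m → Fin n → ℝ}
    {y : α → EuclideanSpace ℝ (Fin m)} (hA : Measurable A) (hy : Measurable y)
    (J : Finset (Fin n)) : Measurable fun a => energy (A a) (y a) J := by
  have hpair : Measurable fun q : (Fin m → Fin n → ℝ) × EuclideanSpace ℝ (Fin m) =>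
      energy q.1 q.2 J := by
    refine measurable_of_Ioi fun t => IsOpen.measurableSet ?_
    simp only [Set.preimage, Set.mem_Ioi, lt_energy_iff, Set.ofPred_exists]
    exact isOpen_iUnion fun c => isOpen_lt continuous_const (by fun_prop)
  exact (hpair.comp (hA.prodMk hy) :)

@[fun_prop]
lemma measurable_obs (x : EuclideanSpace ℝ (Fin n)) :
    Measurable fun ω : Sample m n => obs x ω := by
  refine Continuous.measurable ?_
  unfold obs signal Matrix.mulVec dotProduct
  fun_prop

lemma measurable_gain (x : EuclideanSpace ℝ (Fin n)) (K : Finset (Fin n)) (j : Fin n) :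
    Measurable fun ω : Sample m n => gain ω.1 (obs x ω) K j := by
  unfold gain
  fun_prop

lemma colSpan_insert (A : Fin m → Fin n → ℝ) (K : Finset (Fin n)) (j : Fin n) :
    colSpan A (insert j K) =
      colSpan A K ⊔ Submodule.span ℝ {WithLp.toLp 2 fun i => A i j} := by
  rw [colSpan, colSpan, Finset.coe_insert, Set.image_insert_eq, Submodule.span_insert, sup_comm]

lemma obs_eq_sum (x : EuclideanSpace ℝ (Fin n)) (ω : Sample m n) :
    obs x ω = ∑ j, x j • WithLp.toLp 2 (fun i => ω.1 i j) + WithLp.toLp 2 ω.2 := by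
  ext i
  simp [obs, signal, Matrix.mulVec, dotProduct, mul_comm]

section OrthogonalCoordinates

variable {κ : Type*} {K : Finset (Fin n)} {v : κ → EuclideanSpace ℝ (Fin m)}

lemma gain_eq_score [Fintype κ] {A : Fin m → Fin n → ℝ} (hv : Orthonormal ℝ v)
    (hspan : Submodule.span ℝ (Set.range v) = (colSpan A K)ᗮ)
    (y : EuclideanSpace ℝ (Fin m)) (j : Fin n) :
    gain A y K j = score (coords v fun i => A i j) (coords v y.ofLp) := by
  rw [gain, energy, energy, score, coords_dotProduct_coords hv, coords_dotProduct_coords hv,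
    inner_starProjection_self]
  simp only [colSpan_insert, norm_sq_starProjection_sup_span, hspan, add_sub_cancel_left,
    WithLp.toLp_ofLp]

lemma coords_obs {x : EuclideanSpace ℝ (Fin n)} {i : Fin n}
    (hx : ∀ j, j ∉ K → j ≠ i → x j = 0) {ω : Sample m n}
    (hspan : Submodule.span ℝ (Set.range v) = (colSpan ω.1 K)ᗮ) :
    coords v (obs x ω).ofLp = x i • coords v (fun l => ω.1 l i) + coords v ω.2 := by
  ext a
  have hortho : ∀ j ∈ K, inner ℝ (v a) (WithLp.toLp 2 fun l => ω.1 l j) = 0 := by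
    intro j hj
    have ha : v a ∈ (colSpan ω.1 K)ᗮ := hspan ▸ Submodule.subset_span (Set.mem_range_self a)
    exact (real_inner_comm _ _).trans (ha _ (Submodule.subset_span ⟨j, hj, rfl⟩))
  have hvanish : ∀ j, j ≠ i → inner ℝ (v a) (x j • WithLp.toLp 2 fun l => ω.1 l j) = 0 := by
    intro j hj
    rw [inner_smul_right]
    by_cases hjK : j ∈ K
    · rw [hortho j hjK, mul_zero]
    · rw [hx j hjK hj, zero_mul]
  simp only [coords, WithLp.toLp_ofLp, obs_eq_sum, inner_add_right, inner_sum, Pi.add_apply,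
    Pi.smul_apply, smul_eq_mul]
  rw [Finset.sum_eq_single i (fun j _ => hvanish j) (by simp), inner_smul_right]

end OrthogonalCoordinates

/-- The sample with columns `q.1` at the positions in `K`, columns `q.2.1` at the other positions
and noise `q.2.2`. -/
def assemble (K : Finset (Fin n))
    (q : ({j // j ∈ K} → Fin m → ℝ) × ({j // j ∉ K} → Fin m → ℝ) × (Fin m → ℝ)) : Sample m n :=
  (fun i j => (if h : j ∈ K then q.1 ⟨j, h⟩ else q.2.1 ⟨j, h⟩) i, q.2.2)

lemma measurePreserving_assemble (K : Finset (Fin n)) :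
    MeasurePreserving (assemble (m := m) K)
      ((Measure.pi fun _ => gauss (Fin m) (1 / m)).prod
        ((Measure.pi fun _ => gauss (Fin m) (1 / m)).prod (gauss (Fin m) 1))) (law m n) := by
  have hassoc := (measurePreserving_prodAssoc
    (Measure.pi fun _ : {j // j ∈ K} => gauss (Fin m) (1 / m))
    (Measure.pi fun _ : {j // j ∉ K} => gauss (Fin m) (1 / m)) (gauss (Fin m) 1)).symm _
  have hmerge := (measurePreserving_piEquivPiSubtypeProd
    (fun _ : Fin n => gauss (Fin m) (1 / m)) (· ∈ K)).symm _
  have hswap := measurePreserving_swap_pi (ι := Fin n) (κ := Fin m) (gaussianReal 0 (1 / m))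
  rw [Subsingleton.elim (Subtype.fintype (· ∈ K)) (Finset.Subtype.fintype K)] at hmerge
  exact ((hswap.comp hmerge).prod (MeasurePreserving.id _)).comp hassoc

lemma colSpan_assemble (K : Finset (Fin n)) (g : {j // j ∈ K} → Fin m → ℝ)
    (q : ({j // j ∉ K} → Fin m → ℝ) × (Fin m → ℝ)) :
    colSpan (assemble K (g, q)).1 K =
      Submodule.span ℝ (Set.range fun j => WithLp.toLp 2 (g j)) := by
  rw [colSpan, Set.image_eq_range]
  congr! with ⟨j, hj⟩
  simp_all [assemble]

lemma ae_finrank_orthogonal_span {ι κ : Type*} [Fintype ι] [Fintype κ] {σ : ℝ≥0} (hσ : σ ≠ 0) :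
    ∀ᵐ g ∂Measure.pi (fun _ : ι => gauss κ σ), Module.finrank ℝ
      (Submodule.span ℝ (Set.range fun j => (WithLp.toLp 2 (g j) : EuclideanSpace ℝ κ)))ᗮ =
        Fintype.card κ - Fintype.card ι := by
  obtain ⟨r, hr⟩ : ∃ r, r = min (Fintype.card κ) (Fintype.card ι) := ⟨_, rfl⟩
  let h : Fin r ↪ ι := (Fin.castLEEmb (by omega)).trans (Fintype.equivFin ι).symm.toEmbedding
  filter_upwards [ae_linearIndependent_comp (ι := κ) hσ h (by simp [hr])] with g hg
  set f : ι → EuclideanSpace ℝ κ := fun j => WithLp.toLp 2 (g j)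
  have hlin : LinearIndependent ℝ (f ∘ h) :=
    hg.map' (WithLp.linearEquiv 2 ℝ (κ → ℝ)).symm.toLinearMap (LinearEquiv.ker _)
  have hle : r ≤ Module.finrank ℝ (Submodule.span ℝ (Set.range f)) := by
    simpa [finrank_span_eq_card hlin] using
      Submodule.finrank_mono (Submodule.span_mono (R := ℝ) (Set.range_comp_subset_range h f))
  have hge : Module.finrank ℝ (Submodule.span ℝ (Set.range f)) ≤ Fintype.card ι :=
    finrank_range_le_card f
  have hsum := Submodule.finrank_add_finrank_orthogonal (Submodule.span ℝ (Set.range f))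
  rw [finrank_euclideanSpace] at hsum
  change Module.finrank ℝ (Submodule.span ℝ (Set.range f))ᗮ = _
  omega

end Columns

section Conditioning

variable {m n : ℕ} {x : EuclideanSpace ℝ (Fin n)} {K : Finset (Fin n)} {i : Fin n}

lemma gain_assemble_eq_score {κ : Type*} [Fintype κ] {v : κ → EuclideanSpace ℝ (Fin m)}
    (hv : Orthonormal ℝ v) {g : {j // j ∈ K} → Fin m → ℝ}
    (hspan : Submodule.span ℝ (Set.range v) =
      (Submodule.span ℝ (Set.range fun j => WithLp.toLp 2 (g j)))ᗮ)
    (hi : i ∉ K) (hx : ∀ j, j ∉ K → j ≠ i → x j = 0)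
    (q : ({j // j ∉ K} → Fin m → ℝ) × (Fin m → ℝ)) (j : {j // j ∉ K}) :
    gain (assemble K (g, q)).1 (obs x (assemble K (g, q))) K j =
      score (coords v (q.1 j)) (x i • coords v (q.1 ⟨i, hi⟩) + coords v q.2) := by
  have hcol : ∀ l (hl : l ∉ K), (fun a => (assemble K (g, q)).1 a l) = q.1 ⟨l, hl⟩ := by
    intro l hl
    ext a
    simp [assemble, hl]
  rw [← colSpan_assemble K g q] at hspan
  rw [gain_eq_score hv hspan, coords_obs hx hspan, hcol j j.2, hcol i hi]
  rfl

lemma map_prod_eq_of_ae {α β γ : Type*} [MeasurableSpace α] [MeasurableSpace β]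
    [MeasurableSpace γ] {μ : Measure α} [IsProbabilityMeasure μ] {ν : Measure β} [SFinite ν]
    {ρ : Measure γ} [SFinite ρ] {f : α × β → γ} (hf : Measurable f)
    (h : ∀ᵐ a ∂μ, ν.map (fun b => f (a, b)) = ρ) : (μ.prod ν).map f = ρ :=
  (measurePreserving_snd.comp
    ((MeasurePreserving.id μ).skew_product (g := fun a b => f (a, b)) hf h)).map_eq

theorem identDistrib_gain (hm : 0 < m) (hi : i ∉ K) (hx : ∀ j, j ∉ K → j ≠ i → x j = 0) :
    IdentDistrib (fun ω (j : {j // j ∉ K}) => gain ω.1 (obs x ω) K j)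
      (fun p j => score (p.1 j) (x i • p.1 ⟨i, hi⟩ + p.2)) (law m n)
      ((Measure.pi fun _ => gauss (Fin (m - K.card)) (1 / m)).prod
        (gauss (Fin (m - K.card)) 1)) := by
  have hgain : Measurable fun (ω : Sample m n) (j : {j // j ∉ K}) => gain ω.1 (obs x ω) K j :=
    measurable_pi_lambda _ fun j => measurable_gain x K j
  have hscore : Measurable fun (p : ({j // j ∉ K} → Fin (m - K.card) → ℝ) × _) j =>
      score (p.1 j) (x i • p.1 ⟨i, hi⟩ + p.2) := by fun_prop
  refine ⟨hgain.aemeasurable, hscore.aemeasurable, ?_⟩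
  have hassemble := measurePreserving_assemble (m := m) K
  rw [← hassemble.map_eq, Measure.map_map hgain hassemble.measurable]
  refine map_prod_eq_of_ae (hgain.comp hassemble.measurable) ?_
  filter_upwards [ae_finrank_orthogonal_span (ι := {j // j ∈ K}) (κ := Fin m) (σ := 1 / m)
    (by positivity)] with g hg
  rw [Fintype.card_fin, Fintype.card_coe] at hg
  obtain ⟨v, hv, hspan⟩ := exists_orthonormal_span_eq hg
  have hcoords : MeasurePreserving
      (Prod.map (fun (h : {j // j ∉ K} → Fin m → ℝ) j => coords v (h j)) (coords v))
      ((Measure.pi fun _ => gauss (Fin m) (1 / m)).prod (gauss (Fin m) 1))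
      ((Measure.pi fun _ => gauss (Fin (m - K.card)) (1 / m)).prod
        (gauss (Fin (m - K.card)) 1)) :=
    (measurePreserving_pi _ _ fun _ => measurePreserving_coords _ hv).prod
      (measurePreserving_coords _ hv)
  rw [← hcoords.map_eq, Measure.map_map hscore hcoords.measurable]
  congr with q j
  exact gain_assemble_eq_score hv hspan hi hx q j

end Conditioning

section Moments

variable {m n : ℕ}

lemma memLp_mul_const_gaussianReal (σ : ℝ≥0) (c : ℝ) :
    MemLp (fun t : ℝ => t * c) 2 (gaussianReal 0 σ) :=
  (memLp_id_gaussianReal' 2 (by simp)).mul_const c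

section DotProduct

variable {ι : Type*} [Fintype ι] (σ : ℝ≥0) (x : ι → ℝ)

lemma memLp_dotProduct_gauss : MemLp (fun r => r ⬝ᵥ x) 2 (gauss ι σ) :=
  memLp_finsetSum _ fun j _ => (memLp_mul_const_gaussianReal σ (x j)).comp_measurePreserving
    (measurePreserving_eval (fun _ : ι => gaussianReal 0 σ) j)

lemma integral_dotProduct_gauss : ∫ r, r ⬝ᵥ x ∂gauss ι σ = 0 := by
  simp only [dotProduct]
  rw [integral_finsetSum]
  · refine Finset.sum_eq_zero fun j _ => ?_
    rw [integral_mul_const, integral_comp_eval (μ := fun _ : ι => gaussianReal 0 σ) (i := j)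
      (f := fun t : ℝ => t) (by fun_prop), integral_id_gaussianReal, zero_mul]
  · exact fun j _ => ((memLp_mul_const_gaussianReal σ (x j)).comp_measurePreserving
      (measurePreserving_eval _ j)).integrable one_le_two

lemma integral_sq_dotProduct_gauss : ∫ r, (r ⬝ᵥ x) ^ 2 ∂gauss ι σ = σ * ∑ j, x j ^ 2 := by
  have hvar := variance_sum_pi (μ := fun _ : ι => gaussianReal 0 σ)
    (X := fun j (t : ℝ) => t * x j) fun j => memLp_mul_const_gaussianReal σ (x j)
  have hsum : (∑ j, fun r : ι → ℝ => r j * x j) = fun r => r ⬝ᵥ x := by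
    ext r
    simp [dotProduct]
  have hcoord (c : ℝ) : Var[fun t : ℝ => t * c; gaussianReal 0 σ] = σ * c ^ 2 :=
    (variance_mul_const _ _ _).trans (by rw [variance_fun_id_gaussianReal])
  rw [hsum, variance_of_integral_eq_zero (memLp_dotProduct_gauss σ x).aemeasurable
    (integral_dotProduct_gauss σ x)] at hvar
  rw [hvar, Finset.mul_sum]
  exact Finset.sum_congr rfl fun j _ => hcoord (x j)

end DotProduct

lemma integral_norm_signal_sq (hm : 0 < m) (x : EuclideanSpace ℝ (Fin n)) :
    ∫ ω, ‖signal ω.1 x‖ ^ 2 ∂law m n = ‖x‖ ^ 2 := by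
  have hrow (i : Fin m) : ∫ A : Fin m → Fin n → ℝ, (A i ⬝ᵥ x.ofLp) ^ 2
      ∂(Measure.pi fun _ => gauss (Fin n) (1 / m)) = (1 / m : ℝ≥0) * ‖x‖ ^ 2 := by
    rw [integral_comp_eval (μ := fun _ : Fin m => gauss (Fin n) (1 / m)) (i := i)
      (f := fun r : Fin n → ℝ => (r ⬝ᵥ x.ofLp) ^ 2)
      (memLp_dotProduct_gauss _ _).integrable_sq.aestronglyMeasurable,
      integral_sq_dotProduct_gauss, EuclideanSpace.real_norm_sq_eq]
  have hnorm (A : Fin m → Fin n → ℝ) : ‖signal A x‖ ^ 2 = ∑ i, (A i ⬝ᵥ x.ofLp) ^ 2 := by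
    rw [EuclideanSpace.real_norm_sq_eq]
    rfl
  rw [law, integral_fun_fst (fun A : Fin m → Fin n → ℝ => ‖signal A x‖ ^ 2)]
  simp only [hnorm, probReal_univ, one_smul]
  rw [integral_finsetSum]
  · rw [Finset.sum_congr rfl fun i _ => hrow i]
    simp [hm.ne']
  · exact fun i _ => ((memLp_dotProduct_gauss (1 / m) x.ofLp).comp_measurePreserving
      (measurePreserving_eval (fun _ : Fin m => gauss (Fin n) (1 / m)) i)).integrable_sq

lemma integral_norm_noise_sq (m n : ℕ) :
    ∫ ω, ‖(WithLp.toLp 2 ω.2 : EuclideanSpace ℝ (Fin m))‖ ^ 2 ∂law m n = m := by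
  rw [law, integral_fun_snd
    (fun d : Fin m → ℝ => ‖(WithLp.toLp 2 d : EuclideanSpace ℝ (Fin m))‖ ^ 2)]
  simp only [EuclideanSpace.real_norm_sq_eq, probReal_univ, one_smul]
  rw [integral_finsetSum]
  · rw [Finset.sum_congr rfl fun i _ => integral_comp_eval (μ := fun _ : Fin m => gaussianReal 0 1)
      (i := i) (f := fun t : ℝ => t ^ 2) (by fun_prop)]
    simp [integral_sq_gaussianReal]
  · exact fun i _ => (measurePreserving_eval (fun _ : Fin m => gaussianReal 0 1)
      i).integrable_comp_of_integrable (integrable_pow_gaussianReal 1 2)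

lemma SNR_eq (hm : 0 < m) (x : EuclideanSpace ℝ (Fin n)) : SNR m x = ‖x‖ ^ 2 / m := by
  rw [SNR, integral_norm_signal_sq hm, integral_norm_noise_sq]

end Moments

section SmallestEntry

variable {m n : ℕ} {x : EuclideanSpace ℝ (Fin n)} {i : Fin n}

lemma mem_pattern {j : Fin n} : j ∈ pattern x ↔ x j ≠ 0 := by
  simp [pattern]

variable (hi : i ∈ pattern x) (hmin : ∀ j ∈ pattern x, |x i| ≤ |x j|)

include hi hmin

lemma MAR_eq : MAR x = x i ^ 2 / (‖x‖ ^ 2 / (pattern x).card) := by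
  have : Nonempty (pattern x) := ⟨⟨i, hi⟩⟩
  have hinf : ⨅ j : pattern x, |x j| ^ 2 = |x i| ^ 2 :=
    le_antisymm (ciInf_le (f := fun j : pattern x => |x j| ^ 2)
      ⟨0, by rintro _ ⟨j, rfl⟩; positivity⟩ ⟨i, hi⟩)
      (le_ciInf fun j => pow_le_pow_left₀ (abs_nonneg _) (hmin j j.2) 2)
  rw [MAR, hinf, sq_abs]

lemma MAR_mul_SNR_eq (hm : 0 < m) : MAR x * SNR m x = (pattern x).card * x i ^ 2 / m := by
  have hx : ‖x‖ ≠ 0 := by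
    rw [norm_ne_zero_iff]
    rintro rfl
    simp [mem_pattern] at hi
  have hcard : ((pattern x).card : ℝ) ≠ 0 := Nat.cast_ne_zero.2 (Finset.card_ne_zero_of_mem hi)
  rw [MAR_eq hi hmin, SNR_eq hm]
  field_simp

lemma sub_card_erase_mul_le (hm : 0 < m) {δ L : ℝ} (hL : 0 < L)
    (h : (m : ℝ) < (2 - δ) / (MAR x * SNR m x) * (pattern x).card * L + (pattern x).card - 1) :
    ((m - ((pattern x).erase i).card : ℕ) : ℝ) * (x i ^ 2 / m) ≤ (2 - min δ 1) * L := by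
  have hpos := Finset.card_pos.2 ⟨i, hi⟩
  have hcard : (((pattern x).erase i).card : ℝ) = (pattern x).card - 1 := by
    rw [Finset.card_erase_of_mem hi, Nat.cast_pred hpos]
  have hentry : 0 < x i ^ 2 / m := div_pos (sq_pos_of_ne_zero (mem_pattern.1 hi)) (by positivity)
  have hscale : (2 - δ) / (MAR x * SNR m x) * (pattern x).card * L =
      (2 - δ) * L / (x i ^ 2 / m) := by
    rw [MAR_mul_SNR_eq hi hmin hm]
    field_simp
  have hdim : (m - ((pattern x).erase i).card : ℝ) * (x i ^ 2 / m) ≤ (2 - min δ 1) * L := by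
    rw [← le_div_iff₀ hentry]
    calc (m - ((pattern x).erase i).card : ℝ)
        ≤ (2 - δ) * L / (x i ^ 2 / m) := by linarith
      _ ≤ (2 - min δ 1) * L / (x i ^ 2 / m) := by gcongr; exact min_le_left _ _
  rcases le_total ((pattern x).erase i).card m with hle | hle
  · rwa [Nat.cast_sub hle]
  · rw [Nat.sub_eq_zero_of_le hle, Nat.cast_zero, zero_mul]
    exact mul_nonneg (by linarith [min_le_right δ 1]) hL.le

end SmallestEntry

section SuccessBound

/-- The bound on the probability of success in terms of the relative gap `δ` between the number of
measurements and the threshold, and of `L`, the logarithm of the number of competing columns. -/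
def successBound (δ L : ℝ) : ℝ≥0∞ :=
  ENNReal.ofReal (Real.exp (-(δ / 4 * L)) + 32 / (δ ^ 2 * L))

variable {δ : ℝ} (hδ : 0 < δ)

include hδ

lemma tendsto_successBound : Tendsto (successBound δ) atTop (𝓝 0) := by
  have hexp : Tendsto (fun L : ℝ => Real.exp (-(δ / 4 * L))) atTop (𝓝 0) :=
    Real.tendsto_exp_neg_atTop_nhds_zero.comp (tendsto_id.const_mul_atTop (by positivity))
  have hinv : Tendsto (fun L : ℝ => 32 / (δ ^ 2 * L)) atTop (𝓝 0) :=
    tendsto_const_nhds.div_atTop (tendsto_id.const_mul_atTop (by positivity))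
  have hsum := ENNReal.tendsto_ofReal (hexp.add hinv)
  rwa [add_zero, ENNReal.ofReal_zero] at hsum

variable {L X : ℝ} (hL : 0 < L) (hX : X ≤ (2 - δ) * L)

include hL hX

lemma half_lt_one_sub_mul : X / 2 < (1 - δ / 4) * L := by
  linarith [mul_pos hδ hL]

lemma exp_mul_inv_add_le_successBound {N : ℕ} (hN : Real.exp L ≤ N) :
    ENNReal.ofReal (Real.exp ((1 - δ / 4) * L)) * (N : ℝ≥0∞)⁻¹ +
      ENNReal.ofReal (X / ((1 - δ / 4) * L - X / 2) ^ 2) ≤ successBound δ L := by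
  have hpos : (0 : ℝ) < N := (Real.exp_pos L).trans_le hN
  have hgap : δ / 4 * L ≤ (1 - δ / 4) * L - X / 2 := by linarith [mul_pos hδ hL]
  have hexp : Real.exp ((1 - δ / 4) * L) * (N : ℝ)⁻¹ ≤ Real.exp (-(δ / 4 * L)) := by
    rw [← div_eq_mul_inv, div_le_iff₀ hpos]
    calc Real.exp ((1 - δ / 4) * L) = Real.exp (-(δ / 4 * L)) * Real.exp L := by
          rw [← Real.exp_add]
          ring_nf
      _ ≤ Real.exp (-(δ / 4 * L)) * N := by gcongr
  have hvar : X / ((1 - δ / 4) * L - X / 2) ^ 2 ≤ 32 / (δ ^ 2 * L) :=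
    calc X / ((1 - δ / 4) * L - X / 2) ^ 2 ≤ (2 * L) / (δ / 4 * L) ^ 2 := by
          gcongr
          linarith [mul_pos hδ hL]
      _ = 32 / (δ ^ 2 * L) := by
          field_simp
          ring
  rw [← ENNReal.ofReal_natCast, ← ENNReal.ofReal_inv_of_pos hpos,
    ← ENNReal.ofReal_mul (Real.exp_pos _).le, successBound,
    ENNReal.ofReal_add (Real.exp_pos _).le (by positivity)]
  exact add_le_add (ENNReal.ofReal_le_ofReal hexp) (ENNReal.ofReal_le_ofReal hvar)

end SuccessBound

section MaximumLikelihood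

variable {m n : ℕ} {x : EuclideanSpace ℝ (Fin n)}

section Energy

variable {K : Finset (Fin n)} {i : Fin n}

variable (hm : 0 < m) (hi : i ∉ K) (hx : ∀ j, j ∉ K → j ≠ i → x j = 0) {δ L : ℝ} (hδ : 0 < δ)
  (hL : 0 < L) (hX : ((m - K.card : ℕ) : ℝ) * (x i ^ 2 / m) ≤ (2 - δ) * L)
  (hN : Real.exp L ≤ (n - K.card : ℕ))

include hm hi hx hδ hL hX hN

lemma law_gains_mem_le {S : Set ({j // j ∉ K} → ℝ)} (hS : MeasurableSet S)
    (h : ∀ {u : ℝ≥0} {τ : ℝ}, (u : ℝ) = x i ^ 2 * (1 / m : ℝ≥0) →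
      Fintype.card (Fin (m - K.card)) * u / 2 < τ →
      ((Measure.pi fun _ => gauss (Fin (m - K.card)) (1 / m)).prod (gauss (Fin (m - K.card)) 1))
          {p | (fun j => score (p.1 j) (x i • p.1 ⟨i, hi⟩ + p.2)) ∈ S} ≤
        ENNReal.ofReal (Real.exp τ) * (Fintype.card {j // j ∉ K} : ℝ≥0∞)⁻¹ +
          ENNReal.ofReal (Fintype.card (Fin (m - K.card)) * u /
            (τ - Fintype.card (Fin (m - K.card)) * u / 2) ^ 2)) :
    law m n {ω | (fun j : {j // j ∉ K} => gain ω.1 (obs x ω) K j) ∈ S} ≤ successBound δ L := by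
  have hu : ((‖x i‖₊ ^ 2 / m : ℝ≥0) : ℝ) = x i ^ 2 / m := by simp
  have hcard : Fintype.card {j // j ∉ K} = n - K.card := by
    rw [Fintype.card_subtype_compl, Fintype.card_fin, Fintype.card_coe]
  refine ((identDistrib_gain hm hi hx).measure_mem_eq hS).trans_le ?_
  rw [← hu] at hX
  refine (h (u := ‖x i‖₊ ^ 2 / m) (τ := (1 - δ / 4) * L) (by simp [div_eq_mul_inv]) ?_).trans ?_
  · rw [Fintype.card_fin]
    exact half_lt_one_sub_mul hδ hL hX
  · rw [hcard, Fintype.card_fin]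
    exact exp_mul_inv_add_le_successBound hδ hL hX hN

theorem law_forall_energy_lt_le :
    law m n {ω | ∀ j, j ∉ K → j ≠ i →
      energy ω.1 (obs x ω) (insert j K) < energy ω.1 (obs x ω) (insert i K)} ≤
        successBound δ L := by
  have hS : MeasurableSet {r : {j // j ∉ K} → ℝ | ∀ l, l ≠ ⟨i, hi⟩ → r l < r ⟨i, hi⟩} := by
    simp only [Set.ofPred_forall]
    exact MeasurableSet.iInter fun l => MeasurableSet.iInter fun _ =>
      measurableSet_lt (by fun_prop) (by fun_prop)
  have hgain := law_gains_mem_le hm hi hx hδ hL hX hN hS fun hu hτ =>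
    measure_score_lt_le hu (⟨i, hi⟩ : {j // j ∉ K}) hτ
  refine (measure_mono fun ω hω l hl => ?_).trans hgain
  exact sub_lt_sub_right (hω l l.2 fun h => hl (Subtype.ext h)) _

theorem law_forall_energy_le_le (hK : K.card + 1 < m) :
    law m n {ω | ∀ j, j ∉ K →
      energy ω.1 (obs x ω) (insert j K) ≤ energy ω.1 (obs x ω) (insert i K)} ≤
        successBound δ L := by
  have hS : MeasurableSet {r : {j // j ∉ K} → ℝ | ∀ l, r l ≤ r ⟨i, hi⟩} := by
    simp only [Set.ofPred_forall]
    exact MeasurableSet.iInter fun l => measurableSet_le (by fun_prop) (by fun_prop)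
  have : Nontrivial (Fin (m - K.card)) := Fin.nontrivial_iff_two_le.2 (by omega)
  have hgain := law_gains_mem_le hm hi hx hδ hL hX hN hS fun hu hτ =>
    measure_score_le_le hu (⟨i, hi⟩ : {j // j ∉ K}) hτ (by positivity)
  refine (measure_mono fun ω hω l => ?_).trans hgain
  exact sub_le_sub_right (hω l l.2) _

end Energy

section Threshold

lemma energy_lt_of_mlEstimates_eq_singleton {k : ℕ} {A : Fin m → Fin n → ℝ}
    {y : EuclideanSpace ℝ (Fin m)} {I J : Finset (Fin n)} (h : mlEstimates k A y = {I})
    (hJ : J.card = k) (hne : J ≠ I) : energy A y J < energy A y I := by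
  have hI : I ∈ mlEstimates k A y := h.symm ▸ Set.mem_singleton I
  refine (hI.2 J hJ).lt_of_ne fun heq => hne ?_
  have hJmem : J ∈ mlEstimates k A y := ⟨hJ, fun J' hJ' => heq ▸ hI.2 J' hJ'⟩
  rwa [h] at hJmem

lemma exp_log_sub_le {k c : ℕ} (hkn : k < n) (hck : c ≤ k) :
    Real.exp (Real.log (n - k)) ≤ (n - c : ℕ) := by
  rw [Real.exp_log (sub_pos.2 (by exact_mod_cast hkn)), Nat.cast_sub (hck.trans hkn.le)]
  gcongr

lemma eq_zero_of_notMem_erase_pattern {i : Fin n} :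
    ∀ j, j ∉ (pattern x).erase i → j ≠ i → x j = 0 := by
  intro j hj hji
  simpa [hji, mem_pattern] using hj

lemma card_insert_erase {I : Finset (Fin n)} {i j : Fin n} (hi : i ∈ I) (hj : j ∉ I.erase i) :
    (insert j (I.erase i)).card = I.card := by
  rw [Finset.card_insert_of_notMem hj, Finset.card_erase_add_one hi]

variable {δ : ℝ} (hm : 0 < m) (hpos : (pattern x).Nonempty) (hδ : 0 < δ)
  (hL : 0 < Real.log (n - (pattern x).card)) (hn : (pattern x).card < n)
  (h : (m : ℝ) < (2 - δ) / (MAR x * SNR m x) * (pattern x).card *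
    Real.log (n - (pattern x).card) + (pattern x).card - 1)

include hm hpos hδ hL hn h

theorem law_mlEstimates_eq_singleton_le :
    law m n {ω | mlEstimates (pattern x).card ω.1 (obs x ω) = {pattern x}} ≤
      successBound (min δ 1) (Real.log (n - (pattern x).card)) := by
  obtain ⟨i, hi, hmin⟩ := (pattern x).exists_min_image (fun j => |x j|) hpos
  refine (measure_mono fun ω hω j hj hji => ?_).trans
    (law_forall_energy_lt_le hm (Finset.notMem_erase i _) eq_zero_of_notMem_erase_pattern
      (lt_min hδ one_pos) hL (sub_card_erase_mul_le hi hmin hm hL h)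
      (exp_log_sub_le hn (Finset.card_erase_le)))
  have hne : insert j ((pattern x).erase i) ≠ pattern x := fun heq =>
    hj (Finset.mem_erase.2 ⟨hji, heq ▸ Finset.mem_insert_self j _⟩)
  rw [Finset.insert_erase hi]
  exact energy_lt_of_mlEstimates_eq_singleton hω (card_insert_erase hi hj) hne

theorem law_pattern_mem_mlEstimates_le (hcard : (pattern x).card < m) :
    law m n {ω | pattern x ∈ mlEstimates (pattern x).card ω.1 (obs x ω)} ≤
      successBound (min δ 1) (Real.log (n - (pattern x).card)) := by
  obtain ⟨i, hi, hmin⟩ := (pattern x).exists_min_image (fun j => |x j|) hpos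
  refine (measure_mono fun ω hω j hj => ?_).trans
    (law_forall_energy_le_le hm (Finset.notMem_erase i _) eq_zero_of_notMem_erase_pattern
      (lt_min hδ one_pos) hL (sub_card_erase_mul_le hi hmin hm hL h)
      (exp_log_sub_le hn (Finset.card_erase_le)) (by rwa [Finset.card_erase_add_one hi]))
  rw [Finset.insert_erase hi]
  exact hω.2 _ (card_insert_erase hi hj)

end Threshold

end MaximumLikelihood

section Genie

variable {m n : ℕ}

lemma obs_add_single (z : EuclideanSpace ℝ (Fin n)) (j : Fin n) (v : ℝ) (ω : Sample m n) :
    obs (z + EuclideanSpace.single j v) ω =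
      signal ω.1 z + WithLp.toLp 2 (v • (fun a => ω.1 a j) + ω.2) := by
  ext a
  simp [obs, signal, Matrix.mulVec_add, add_assoc]

lemma measurePreserving_smul_column (j : Fin n) {v : ℝ} {u : ℝ≥0}
    (hu : (u : ℝ) = v ^ 2 * (1 / m : ℝ≥0)) :
    MeasurePreserving (fun (A : Fin m → Fin n → ℝ) => v • fun a => A a j)
      (Measure.pi fun _ => gauss (Fin n) (1 / m)) (gauss (Fin m) u) :=
  (measurePreserving_smul_gauss hu).comp
    ((measurePreserving_eval _ j).comp (measurePreserving_swap_pi _))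

/-- The candidates `c a` share a single reference law of `(A, y)`, under which one of the disjoint
events `E a` has probability at most `1 / card ι`. -/
theorem exists_law_obs_mem_le {ι : Type*} [Fintype ι] [Nonempty ι] (c : ι → Fin n)
    (z : EuclideanSpace ℝ (Fin n)) {E : ι → Set ((Fin m → Fin n → ℝ) × EuclideanSpace ℝ (Fin m))}
    (hE : ∀ a, MeasurableSet (E a)) (hdisj : Pairwise (Function.onFun Disjoint E)) {v : ℝ}
    {u : ℝ≥0} (hu : (u : ℝ) = v ^ 2 * (1 / m : ℝ≥0)) {τ : ℝ} (hτ : m * u / 2 < τ) :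
    ∃ a, law m n {ω | (ω.1, obs (z + EuclideanSpace.single (c a) v) ω) ∈ E a} ≤
      ENNReal.ofReal (Real.exp τ) * (Fintype.card ι : ℝ≥0∞)⁻¹ +
        ENNReal.ofReal (m * u / (τ - m * u / 2) ^ 2) := by
  let Φ : Sample m n → (Fin m → Fin n → ℝ) × EuclideanSpace ℝ (Fin m) := fun p =>
    (p.1, obs z p)
  have hΦ : Measurable Φ := measurable_fst.prodMk (measurable_obs z)
  obtain ⟨a, ha⟩ := exists_measure_le_inv_card
    ((Measure.pi fun _ : Fin m => gauss (Fin n) (1 / m)).prod (gauss (Fin m) (1 + u)))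
    (fun a => hΦ (hE a)) fun a b hab => (hdisj hab).preimage Φ
  have hmain := measure_prod_gauss_le (measurePreserving_smul_column (c a) hu)
    (by rwa [Fintype.card_fin]) (hΦ (hE a))
  rw [Fintype.card_fin] at hmain
  refine ⟨a, le_trans ?_ (hmain.trans (by gcongr))⟩
  simp only [obs_add_single]
  exact le_rfl

end Genie

section TwoLevel

variable {m n : ℕ} {v w : ℝ} {e j : Fin n} {J K : Finset (Fin n)}

/-- The vector with entry `w` at `e`, entry `v` at the other indices of `J`, and `0` elsewhere. For
`v ≤ w` it attains any prescribed norm and minimum-to-average ratio, and all its small entries are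
interchangeable. -/
def twoLevel (v w : ℝ) (e : Fin n) (J : Finset (Fin n)) : EuclideanSpace ℝ (Fin n) :=
  WithLp.toLp 2 fun l => if l = e then w else if l ∈ J then v else 0

lemma twoLevel_insert (v w : ℝ) (he : e ∈ K) (hj : j ∉ K) :
    twoLevel v w e (insert j K) = twoLevel v w e K + EuclideanSpace.single j v := by
  have hje : j ≠ e := fun h => hj (h ▸ he)
  ext l
  rcases eq_or_ne l j with rfl | hl
  · simp [twoLevel, hje, hj]
  · simp [twoLevel, hl]

lemma norm_sq_twoLevel (v w : ℝ) (he : e ∈ J) :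
    ‖twoLevel v w e J‖ ^ 2 = w ^ 2 + (J.card - 1) * v ^ 2 := by
  have hentry (l : Fin n) : twoLevel v w e J l ^ 2 =
      (if l = e then w ^ 2 - v ^ 2 else 0) + if l ∈ J then v ^ 2 else 0 := by
    rcases eq_or_ne l e with rfl | hl
    · simp [twoLevel, he]
    · by_cases hJ : l ∈ J <;> simp [twoLevel, hl, hJ]
  simp only [EuclideanSpace.real_norm_sq_eq, hentry, Finset.sum_add_distrib, Finset.sum_ite_eq',
    Finset.mem_univ, if_true, Finset.sum_ite_mem, Finset.univ_inter, Finset.sum_const, nsmul_eq_mul]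
  ring

section Positive

variable (hv : 0 < v) (hvw : v ≤ w) (he : e ∈ J)

include hv hvw he

lemma pattern_twoLevel : pattern (twoLevel v w e J) = J := by
  ext l
  rw [mem_pattern]
  rcases eq_or_ne l e with rfl | hl
  · simp [twoLevel, he, (hv.trans_le hvw).ne']
  · simp [twoLevel, hl, hv.ne']

lemma MAR_twoLevel (hj : j ∈ J) (hje : j ≠ e) :
    MAR (twoLevel v w e J) = v ^ 2 / (‖twoLevel v w e J‖ ^ 2 / J.card) := by
  have hpattern := pattern_twoLevel hv hvw he
  have hentry : twoLevel v w e J j = v := by simp [twoLevel, hje, hj]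
  rw [MAR_eq (i := j) (by rwa [hpattern]), hentry, hpattern]
  intro l hl
  rw [hpattern] at hl
  have hle : v ≤ twoLevel v w e J l := by
    rcases eq_or_ne l e with rfl | h
    · simpa [twoLevel] using hvw
    · simp [twoLevel, h, hl]
  rw [hentry]
  exact abs_le_abs_of_nonneg hv.le hle

end Positive

lemma exists_sq_eq_and_sq_add_eq {t ρ k : ℝ} (ht : 0 < t) (hρ : 0 < ρ) (hρ1 : ρ ≤ 1)
    (hk : 0 < k) :
    ∃ v w : ℝ, 0 < v ∧ v ≤ w ∧ v ^ 2 = ρ * t / k ∧ w ^ 2 + (k - 1) * v ^ 2 = t := by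
  have hv : 0 < ρ * t / k := by positivity
  have hle : ρ * t / k ≤ t - (k - 1) * (ρ * t / k) := by
    have hcancel : ρ * t / k * k = ρ * t := div_mul_cancel₀ _ hk.ne'
    linarith [mul_le_of_le_one_left ht.le hρ1]
  refine ⟨√(ρ * t / k), √(t - (k - 1) * (ρ * t / k)), Real.sqrt_pos.2 hv, Real.sqrt_le_sqrt hle,
    Real.sq_sqrt hv.le, ?_⟩
  rw [Real.sq_sqrt hv.le, Real.sq_sqrt (hv.le.trans hle), sub_add_cancel]

end TwoLevel

section HardVector

variable {m n k : ℕ} {s ρ : ℝ}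

lemma SNR_MAR_twoLevel_insert (hm : 0 < m) {K : Finset (Fin n)} {e j : Fin n} (he : e ∈ K)
    (hj : j ∉ K) (hK : K.card + 1 = k) {v w : ℝ} (hv : 0 < v) (hvw : v ≤ w)
    (hs : 0 < s) (hvk : v ^ 2 = ρ * (s * m) / k) (hw : w ^ 2 + (k - 1) * v ^ 2 = s * m) :
    (pattern (twoLevel v w e (insert j K))).card = k ∧
      SNR m (twoLevel v w e (insert j K)) = s ∧ MAR (twoLevel v w e (insert j K)) = ρ := by
  have he' := Finset.mem_insert_of_mem (b := j) he
  have hcard : (insert j K).card = k := by rw [Finset.card_insert_of_notMem hj, hK]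
  have hnorm : ‖twoLevel v w e (insert j K)‖ ^ 2 = s * m := by
    rw [norm_sq_twoLevel v w he', hcard, hw]
  have hk : 0 < k := by omega
  refine ⟨by rw [pattern_twoLevel hv hvw he', hcard], ?_, ?_⟩
  · rw [SNR_eq hm, hnorm]
    field_simp
  · rw [MAR_twoLevel hv hvw he' (Finset.mem_insert_self j K) (ne_of_mem_of_not_mem he hj).symm,
      hnorm, hcard, hvk]
    field_simp

theorem exists_law_est_eq_pattern_le (hm : 0 < m) (hk : 2 ≤ k) (hkn : k < n)
    (hL : 0 < Real.log (n - k)) (hs : 0 < s) (hρ : 0 < ρ) (hρ1 : ρ ≤ 1)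
    {est : (Fin m → Fin n → ℝ) × EuclideanSpace ℝ (Fin m) → Finset (Fin n)}
    (hest : ∀ J, MeasurableSet (est ⁻¹' {J})) :
    ∃ x : EuclideanSpace ℝ (Fin n), ((pattern x).card = k ∧ SNR m x = s ∧ MAR x = ρ) ∧
      (ρ * (s * m) / k ≤ Real.log (n - k) →
        law m n {ω | est (ω.1, obs x ω) = pattern x} ≤ successBound 1 (Real.log (n - k))) := by
  obtain ⟨v, w, hv, hvw, hvk, hw⟩ := exists_sq_eq_and_sq_add_eq (k := k)
    (show 0 < s * (m : ℝ) by positivity) hρ hρ1 (by positivity)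
  obtain ⟨K, -, hK⟩ := Finset.exists_subset_card_eq
    (s := (Finset.univ : Finset (Fin n))) (n := k - 1) (by rw [Finset.card_fin]; omega)
  obtain ⟨e, he⟩ : K.Nonempty := Finset.card_pos.1 (by omega)
  obtain ⟨j₀, -, hj₀⟩ := Finset.exists_mem_notMem_of_card_lt_card
    (s := K) (t := Finset.univ) (by rw [Finset.card_fin]; omega)
  have hgood (j : {j // j ∉ K}) := SNR_MAR_twoLevel_insert (k := k) hm he j.2 (by omega) hv hvw hs
    hvk hw
  rcases lt_or_ge (Real.log (n - k)) (ρ * (s * m) / k) with hlt | hle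
  · exact ⟨_, hgood ⟨j₀, hj₀⟩, fun hle => absurd hle hlt.not_ge⟩
  have : Nonempty {j // j ∉ K} := ⟨⟨j₀, hj₀⟩⟩
  have hu : ((‖v‖₊ ^ 2 / m : ℝ≥0) : ℝ) = v ^ 2 * (1 / m : ℝ≥0) := by simp [div_eq_mul_inv]
  have hX : (m : ℝ) * (‖v‖₊ ^ 2 / m : ℝ≥0) ≤ (2 - 1) * Real.log (n - k) := by
    rw [hu, hvk]
    push_cast
    field_simp at hle ⊢
    linarith
  have hinj (a b : {j // j ∉ K}) (h : insert a.1 K = insert b.1 K) : a = b :=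
    Subtype.ext ((Finset.insert_inj a.2).1 h)
  obtain ⟨j, hj⟩ := exists_law_obs_mem_le (ι := {j // j ∉ K}) Subtype.val (twoLevel v w e K)
    (fun a => hest (insert a.1 K))
    (fun a b hab => pairwise_disjoint_fiber est fun h => hab (hinj a b h)) hu
    (half_lt_one_sub_mul one_pos hL hX)
  refine ⟨twoLevel v w e (insert j.1 K), hgood j, fun _ => ?_⟩
  have hcard : Fintype.card {j // j ∉ K} = n - K.card := by
    rw [Fintype.card_subtype_compl, Fintype.card_fin, Fintype.card_coe]
  rw [← twoLevel_insert v w he j.2, hcard] at hj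
  rw [pattern_twoLevel hv hvw (Finset.mem_insert_of_mem he)]
  exact hj.trans (exp_mul_inv_add_le_successBound one_pos hL hX (exp_log_sub_le hkn (by omega)))

end HardVector

section Asymptotics

variable {k m : ℕ → ℕ}

lemma tendsto_successBound_log {δ : ℝ} (hδ : 0 < δ)
    (hnk : Tendsto (fun n : ℕ => (n : ℝ) - k n) atTop atTop) :
    Tendsto (fun n : ℕ => successBound δ (Real.log ((n : ℝ) - k n))) atTop (𝓝 0) :=
  (tendsto_successBound hδ).comp (Real.tendsto_log_atTop.comp hnk)

lemma eventually_lt_and_log_pos (hnk : Tendsto (fun n : ℕ => (n : ℝ) - k n) atTop atTop) :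
    ∀ᶠ n in atTop, k n < n ∧ 0 < Real.log ((n : ℝ) - k n) := by
  filter_upwards [hnk.eventually_gt_atTop 1] with n hn
  exact ⟨by rify; linarith, Real.log_pos hn⟩

variable (hm : ∀ᶠ n in atTop, 0 < m n)
  (hnk : Tendsto (fun n : ℕ => (n : ℝ) - k n) atTop atTop)

include hm hnk

section MaximumLikelihood

variable {x : (n : ℕ) → EuclideanSpace ℝ (Fin n)} (hk : ∀ᶠ n in atTop, 0 < k n)
  (hx : ∀ᶠ n in atTop, (pattern (x n)).card = k n) {δ : ℝ} (hδ : 0 < δ)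
  (h : ∀ᶠ n : ℕ in atTop, (m n : ℝ) <
    (2 - δ) / (MAR (x n) * SNR (m n) (x n)) * k n * Real.log ((n : ℝ) - k n) + k n - 1)

include hk hx hδ h

theorem tendsto_law_mlEstimates_eq_singleton :
    Tendsto (fun n => law (m n) n
      {ω | mlEstimates (k n) ω.1 (obs (x n) ω) = {pattern (x n)}}) atTop (𝓝 0) := by
  refine tendsto_of_tendsto_of_tendsto_of_le_of_le' tendsto_const_nhds
    (tendsto_successBound_log (lt_min hδ one_pos) hnk) (Eventually.of_forall fun _ => zero_le) ?_
  filter_upwards [hm, eventually_lt_and_log_pos hnk, hk, hx, h] with n hm ⟨hkn, hL⟩ hk hx h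
  rw [← hx] at hkn hL hk h ⊢
  exact law_mlEstimates_eq_singleton_le hm (Finset.card_pos.1 hk) hδ hL hkn h

theorem tendsto_law_pattern_mem_mlEstimates (hkm : ∀ᶠ n in atTop, k n < m n) :
    Tendsto (fun n => law (m n) n
      {ω | pattern (x n) ∈ mlEstimates (k n) ω.1 (obs (x n) ω)}) atTop (𝓝 0) := by
  refine tendsto_of_tendsto_of_tendsto_of_le_of_le' tendsto_const_nhds
    (tendsto_successBound_log (lt_min hδ one_pos) hnk) (Eventually.of_forall fun _ => zero_le) ?_
  filter_upwards [hm, eventually_lt_and_log_pos hnk, hk, hx, h, hkm]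
    with n hm ⟨hkn, hL⟩ hk hx h hkm
  rw [← hx] at hkn hL hk h hkm ⊢
  exact law_pattern_mem_mlEstimates_le hm (Finset.card_pos.1 hk) hδ hL hkn h hkm

end MaximumLikelihood

theorem isBigO_mul_log_of_tendsto_law_est_eq_pattern (hk : ∀ᶠ n in atTop, 2 ≤ k n) {s ρ : ℝ}
    (hs : 0 < s) (hρ : 0 < ρ) (hρ1 : ρ ≤ 1)
    {est : (n : ℕ) → (Fin (m n) → Fin n → ℝ) × EuclideanSpace ℝ (Fin (m n)) → Finset (Fin n)}
    (hest : ∀ n J, MeasurableSet (est n ⁻¹' {J}))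
    (hsucc : ∀ x : (n : ℕ) → EuclideanSpace ℝ (Fin n),
      (∀ᶠ n in atTop, (pattern (x n)).card = k n ∧ SNR (m n) (x n) = s ∧ MAR (x n) = ρ) →
      Tendsto (fun n => law (m n) n
        {ω | est n (ω.1, obs (x n) ω) = pattern (x n)}) atTop (𝓝 1)) :
    (fun n : ℕ => (k n : ℝ) * Real.log ((n : ℝ) - k n)) =O[atTop] fun n => (m n : ℝ) := by
  have hhard := (hm.and (hk.and (eventually_lt_and_log_pos hnk))).mono
    fun n ⟨hm, hk, hkn, hL⟩ => exists_law_est_eq_pattern_le hm hk hkn hL hs hρ hρ1 (hest n)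
  obtain ⟨x, hx⟩ := Filter.skolem.1 hhard
  refine IsBigO.of_bound (ρ * s) ?_
  filter_upwards [hx, hk, eventually_lt_and_log_pos hnk,
    (hsucc x (hx.mono fun _ h => h.1)).eventually_const_lt (u := 2⁻¹) (by simp),
    (tendsto_successBound_log one_pos hnk).eventually_lt_const (u := 2⁻¹) (by simp)]
    with n ⟨_, hfail⟩ hk ⟨_, hL⟩ hlower hupper
  have hlt : Real.log (n - k n) < ρ * (s * m n) / k n :=
    not_le.1 fun hle => ((hfail hle).trans_lt hupper).not_gt hlower
  rw [lt_div_iff₀ (by positivity)] at hlt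
  rw [Real.norm_of_nonneg (by positivity), Real.norm_of_nonneg (by positivity)]
  linarith

end Asymptotics

end SparseRecovery

end

open SparseRecovery in
theorem theorem1_general (k m : ℕ → ℕ) (hm : ∀ᶠ n in atTop, 0 < m n)
    (hk : ∀ᶠ n in atTop, 0 < k n)
    (hnk : Tendsto (fun n : ℕ => (n : ℝ) - k n) atTop atTop) :
    (∀ x : (n : ℕ) → EuclideanSpace ℝ (Fin n),
      (∀ᶠ n in atTop, (pattern (x n)).card = k n) →
      ∀ δ : ℝ, 0 < δ →
      (∀ᶠ n : ℕ in atTop, (m n : ℝ) <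
        (2 - δ) / (MAR (x n) * SNR (m n) (x n)) * k n * Real.log ((n : ℝ) - k n) + k n - 1) →
      Tendsto (fun n => law (m n) n
        {ω | mlEstimates (k n) ω.1 (obs (x n) ω) = {pattern (x n)}}) atTop (𝓝 0) ∧
      ((∀ᶠ n in atTop, k n < m n) →
        Tendsto (fun n => law (m n) n
          {ω | pattern (x n) ∈ mlEstimates (k n) ω.1 (obs (x n) ω)}) atTop (𝓝 0))) ∧
    ((∀ᶠ n in atTop, 2 ≤ k n) →
      ∀ s ρ : ℝ, 0 < s → 0 < ρ → ρ ≤ 1 →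
      ∀ est : (n : ℕ) →
        (Fin (m n) → Fin n → ℝ) × EuclideanSpace ℝ (Fin (m n)) → Finset (Fin n),
      (∀ n J, MeasurableSet (est n ⁻¹' {J})) →
      (∀ x : (n : ℕ) → EuclideanSpace ℝ (Fin n),
        (∀ᶠ n in atTop,
          (pattern (x n)).card = k n ∧ SNR (m n) (x n) = s ∧ MAR (x n) = ρ) →
        Tendsto (fun n => law (m n) n
          {ω | est n (ω.1, obs (x n) ω) = pattern (x n)}) atTop (𝓝 1)) →
      (fun n : ℕ => (k n : ℝ) * Real.log ((n : ℝ) - k n)) =O[atTop] fun n => (m n : ℝ)) :=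
  ⟨fun _ hx _ hδ h => ⟨tendsto_law_mlEstimates_eq_singleton hm hnk hk hx hδ h,
      tendsto_law_pattern_mem_mlEstimates hm hnk hk hx hδ h⟩,
    fun hk _ _ hs hρ hρ1 _ hest hsucc =>
      isBigO_mul_log_of_tendsto_law_est_eq_pattern hm hnk hk hs hρ hρ1 hest hsucc⟩

open SparseRecovery in
theorem theorem1 (k m : ℕ → ℕ) (hm : ∀ᶠ n in atTop, 0 < m n)
    (hk : Tendsto k atTop atTop)
    (hnk : Tendsto (fun n : ℕ => (n : ℝ) - k n) atTop atTop) :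
    -- failure of the maximum likelihood estimator
    (∀ x : (n : ℕ) → EuclideanSpace ℝ (Fin n),
      (∀ᶠ n in atTop, (pattern (x n)).card = k n) →
      ∀ δ : ℝ, 0 < δ →
      (∀ᶠ n : ℕ in atTop, (m n : ℝ) <
        (2 - δ) / (MAR (x n) * SNR (m n) (x n)) * k n * Real.log ((n : ℝ) - k n) + k n - 1) →
      -- the true pattern is the (unique) maximizer
      Tendsto (fun n => law (m n) n
        {ω | mlEstimates (k n) ω.1 (obs (x n) ω) = {pattern (x n)}}) atTop (𝓝 0) ∧
      -- if `m > k`, the same holds whatever the rule that breaks ties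
      ((∀ᶠ n in atTop, k n < m n) →
        Tendsto (fun n => law (m n) n
          {ω | pattern (x n) ∈ mlEstimates (k n) ω.1 (obs (x n) ω)}) atTop (𝓝 0))) ∧
    -- for fixed SNR and MAR, `m = Ω(k log (n - k))` is necessary for any estimator that recovers
    -- the pattern of every `k`-sparse vector with probability tending to one
    (∀ s ρ : ℝ, 0 < s → 0 < ρ → ρ ≤ 1 →
      ∀ est : (n : ℕ) →
        (Fin (m n) → Fin n → ℝ) × EuclideanSpace ℝ (Fin (m n)) → Finset (Fin n),
      (∀ n J, MeasurableSet (est n ⁻¹' {J})) →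
      (∀ x : (n : ℕ) → EuclideanSpace ℝ (Fin n),
        (∀ᶠ n in atTop,
          (pattern (x n)).card = k n ∧ SNR (m n) (x n) = s ∧ MAR (x n) = ρ) →
        Tendsto (fun n => law (m n) n
          {ω | est n (ω.1, obs (x n) ω) = pattern (x n)}) atTop (𝓝 1)) →
      (fun n : ℕ => (k n : ℝ) * Real.log ((n : ℝ) - k n)) =O[atTop] fun n => (m n : ℝ)) := by
  have h := theorem1_general k m hm (hk.eventually_gt_atTop 0) hnk
  exact ⟨h.1, h.2 (hk.eventually_ge_atTop 2)⟩
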